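/- Let $g \ge 1$ and let $f = x^{2g+1} + c_2 x^{2g-1} + \dots + c_{2g+1} \in \mathbb{Z}[x]$ be a polynomial of nonzero discriminant, with roots $\omega_1, \dots, \omega_{2g+1} \in \mathbb{C}$. Let $(U,V,R)$ be a Mumford triple for $f$ over $\mathbb{Q}$, i.e. $U, V, R \in \mathbb{Q}[x]$, $U$ is monic of degree $m \le g$, $V$ is monic of degree $2g+1-m$, $\deg R \le m-1$ (so $R=0$ if $m=0$), and $UV = f - R^2$. It represents a divisor $D = \sum_{i=1}^m P_i - mP_\infty$ on the curve $C_f : y^2 = f(x)$, and $I_D = H^0(C_f^0, \mathcal{O}(-D))$ is the ideal $(U,\, y-R)$ of $\mathbb{Q}[x,y]/(y^2-f)$, where $C_f^0$ is the affine curve. Put $W_D = I_D / yI_D$ and $A_f = \mathbb{Q}[x]/(f)$; let $T_D$ be multiplication by $x$ on $W_D$. Let $\iota$ be the involution $y \mapsto -y$, let $\tau : A_f \to \mathbb{Q}$ send the class of a polynomial of degree $\le 2g$ to its coefficient of $x^{2g}$, and equip $W_D$ with the symmetric bilinear form $$(a, b)_{W_D} = (-1)^{\deg U}\, \tau\bigl(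 a\,\iota(b)/U \bmod y \bigr) \qquad (a, b \in I_D).$$ A $\mathbb{Z}$-lattice in $W_D$ is the $\mathbb{Z}$-span $L$ of a $\mathbb{Q}$-basis of $W_D$ on which $(\cdot,\cdot)_{W_D}$ takes integer values and induces an isomorphism $L \cong \mathrm{Hom}(L, \mathbb{Z})$. A vector of $L$ is primitive if it is not of the form $nw$ with $w \in L$, $n \in \mathbb{Z} \setminus \{\pm 1\}$. Let $M \ge 1$ be the least positive integer such that $MU \in \mathbb{Z}[x]$. Then $M = N^2$ for some $N \in \mathbb{N}$. Suppose in addition that $U$ and $f$ are coprime in $\mathbb{Q}[x]$. Then there is a unique inner product $\langle\cdot,\cdot\rangle_{H_{T_D}}$ (positive definite symmetric bilinear form) on $W_D \otimes_{\mathbb{Q}} \mathbb{R}$ such that (i) the linear map $\theta$ defined by $\langle \theta v, w\rangle_{H_{T_D}} = (v,w)_{W_D}$ is an isometry of $\langle\cdot,\cdot\rangle_{H_{T_D}}$, and (ii) $T_D$ commutes with its $\langle\cdot,\cdot\rangle_{H_{T_D}}$-adjoint. Moreover there is a $\mathbb{Z}$-lattice $M_D \subset W_D$ with $T_D M_D \subset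 M_D$ that contains the vector $v_D = NU$ (the class of $NU \in I_D$) as a primitive vector, and $$\langle v_D, v_D \rangle_{H_{T_D}} = M \sum_{i=1}^{2g+1} \frac{|U(\omega_i)|}{|f'(\omega_i)|}.$$ -/

import Mathlib

open Polynomial TensorProduct

/-- A Mumford triple `(U, V, R)` for the polynomial `f` of degree `2g + 1` over a field `k`.
It represents the reduced divisor `D = ∑ Pᵢ - m P_∞` on `y² = f(x)`, where `m = deg U`, the
`x(Pᵢ)` are the roots of `U` and `y(Pᵢ) = R(x(Pᵢ))`. -/
structure MumfordTriple {k : Type*} [Field k] (g : ℕ) (f : k[X]) where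
  U : k[X]
  V : k[X]
  R : k[X]
  monic_U : U.Monic
  natDegree_U_le : U.natDegree ≤ g
  monic_V : V.Monic
  natDegree_V : V.natDegree = 2 * g + 1 - U.natDegree
  degree_R_lt : R.degree < (U.natDegree : WithBot ℕ)
  mul_eq : U * V = f - R ^ 2

/-- The coordinate ring `k[x, y] / (y² - f(x))` of the affine hyperelliptic curve `C_f⁰`, where
`k[x, y]` is viewed as `k[x][y]`. -/
abbrev CurveRing {k : Type*} [Field k] (f : k[X]) : Type _ :=
  AdjoinRoot (X ^ 2 - C f : k[X][X])

namespace CurveRing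

variable {k : Type*} [Field k] (f : k[X])

/-- A polynomial in `x`, viewed as a function on the curve. -/
noncomputable def ofPoly : k[X] →+* CurveRing f :=
  AdjoinRoot.of (X ^ 2 - C f : k[X][X])

/-- The coordinate function `y`. -/
noncomputable def y : CurveRing f :=
  AdjoinRoot.root (X ^ 2 - C f : k[X][X])

theorem y_sq : y f ^ 2 = ofPoly f f := by
  have h := AdjoinRoot.eval₂_root (X ^ 2 - C f : k[X][X])
  rw [eval₂_sub, eval₂_pow, eval₂_X, eval₂_C, sub_eq_zero] at h
  exact h

/-- The hyperelliptic involution `ι`, acting on functions by `x ↦ x`, `y ↦ -y`. -/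
noncomputable def conj : CurveRing f →+* CurveRing f :=
  AdjoinRoot.lift (ofPoly f) (-y f) (by simp [y_sq])

@[simp] theorem conj_ofPoly (p : k[X]) : conj f (ofPoly f p) = ofPoly f p :=
  AdjoinRoot.lift_of _

@[simp] theorem conj_y : conj f (y f) = -y f :=
  AdjoinRoot.lift_root _

/-- Reduction modulo `y`: the map `k[x, y] / (y² - f) → A_f = k[x] / (f)`, `x ↦ x`, `y ↦ 0`. -/
noncomputable def modY : CurveRing f →+* AdjoinRoot f :=
  AdjoinRoot.lift (AdjoinRoot.mk f) 0 (by simp)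

@[simp] theorem modY_ofPoly (p : k[X]) : modY f (ofPoly f p) = AdjoinRoot.mk f p :=
  AdjoinRoot.lift_of _

@[simp] theorem modY_y : modY f (y f) = 0 :=
  AdjoinRoot.lift_root _

@[simp] theorem modY_conj (a : CurveRing f) : modY f (conj f a) = modY f a := by
  have h : (modY f).comp (conj f) = modY f := by
    apply Ideal.Quotient.ringHom_ext
    apply Polynomial.ringHom_ext
    · intro p
      change modY f (conj f (ofPoly f p)) = modY f (ofPoly f p)
      simp
    · change modY f (conj f (y f)) = modY f (y f)
      simp
  exact congrArg (fun φ : CurveRing f →+* AdjoinRoot f => φ a) h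

theorem smul_eq (c : k) (a : CurveRing f) : c • a = ofPoly f (C c) * a := by
  rw [Algebra.smul_def]
  rfl

theorem conj_smul (c : k) (a : CurveRing f) : conj f (c • a) = c • conj f a := by
  simp [smul_eq]

theorem modY_smul (c : k) (a : CurveRing f) : modY f (c • a) = c • modY f a := by
  rw [smul_eq, map_mul, modY_ofPoly, Algebra.smul_def]
  rfl

/-- Multiplication by a nonzero polynomial in `x` is injective on the coordinate ring. -/
theorem ofPoly_mul_cancel {p : k[X]} (hp : p ≠ 0) {a b : CurveRing f}
    (h : ofPoly f p * a = ofPoly f p * b) : a = b := by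
  have hm : (X ^ 2 - C f : k[X][X]).Monic := monic_X_pow_sub_C f two_ne_zero
  have : Module.Free k[X] (CurveRing f) := hm.free_adjoinRoot
  refine smul_right_injective (CurveRing f) hp ?_
  simp only [Algebra.smul_def]
  exact h

end CurveRing

/-- The linear form `τ : A_f = k[x] / (f) → k` for `f` monic of degree `2g + 1`: it sends the class
of a polynomial of degree `≤ 2g` to its coefficient of `x ^ (2g)`. -/
noncomputable def tauForm {k : Type*} [Field k] (g : ℕ) {f : k[X]} (hf : f.Monic) :
    AdjoinRoot f →ₗ[k] k :=
  (Polynomial.lcoeff k (2 * g)).comp (AdjoinRoot.modByMonicHom hf)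

namespace MumfordTriple

open CurveRing

variable {k : Type*} [Field k] {g : ℕ} {f : k[X]} (D : MumfordTriple g f)

theorem monic_f {k : Type*} [Field k] {g : ℕ} {f : k[X]} (D : MumfordTriple g f) :
    f.Monic := by
  have h : f = D.U * D.V + D.R ^ 2 := by rw [D.mul_eq]; ring
  rw [h]
  refine Monic.add_of_left (D.monic_U.mul D.monic_V) ?_
  have hU := D.natDegree_U_le
  rw [degree_eq_natDegree (D.monic_U.mul D.monic_V).ne_zero,
    D.monic_U.natDegree_mul D.monic_V, D.natDegree_V]
  by_cases hR : D.R = 0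
  · rw [hR, zero_pow two_ne_zero, degree_zero]
    exact WithBot.bot_lt_coe _
  · have h1 := D.degree_R_lt
    rw [degree_eq_natDegree hR, Nat.cast_lt] at h1
    rw [degree_eq_natDegree (pow_ne_zero 2 hR), natDegree_pow, Nat.cast_lt]
    omega

/-- `H⁰(C_f⁰, 𝒪(-D))`: the ideal `(U, y - R)` of functions on the affine curve `C_f⁰` which vanish
along the effective divisor `∑ Pᵢ`. -/
noncomputable def ideal : Ideal (CurveRing f) :=
  Ideal.span {ofPoly f D.U, y f - ofPoly f D.R}

/-- The submodule `y · H⁰(C_f⁰, 𝒪(-D))`. -/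
noncomputable def yMul : Submodule (CurveRing f) D.ideal :=
  Ideal.span {y f} • ⊤

/-- The space `W_D = H⁰(C_f⁰, 𝒪(-D)) / (y)`. -/
def W : Type _ := D.ideal ⧸ D.yMul

noncomputable instance : AddCommGroup D.W :=
  inferInstanceAs (AddCommGroup (D.ideal ⧸ D.yMul))

noncomputable instance : Module (CurveRing f) D.W :=
  inferInstanceAs (Module (CurveRing f) (D.ideal ⧸ D.yMul))

noncomputable instance : Module k D.W :=
  inferInstanceAs (Module k (D.ideal ⧸ D.yMul))

noncomputable instance : IsScalarTower k (CurveRing f) D.W :=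
  inferInstanceAs (IsScalarTower k (CurveRing f) (D.ideal ⧸ D.yMul))

/-- The class in `W_D` of a section of `𝒪(-D)`. -/
noncomputable def toW : D.ideal →ₗ[CurveRing f] D.W :=
  D.yMul.mkQ

/-- The class of `U` in `W_D`. -/
noncomputable def classU : D.W :=
  D.toW ⟨ofPoly f D.U, Ideal.subset_span (by simp)⟩

/-- The operator `T_D` on `W_D`, `T_D v = x v`. -/
noncomputable def T : D.W →ₗ[k] D.W :=
  Algebra.lsmul k k D.W (ofPoly f X)

theorem ofPoly_V_eq :
    (y f - ofPoly f D.R) * (y f + ofPoly f D.R) = ofPoly f D.U * ofPoly f D.V := by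
  rw [← map_mul, D.mul_eq, map_sub, map_pow, ← y_sq]
  ring

/-- `I_D · ι(I_D) ⊆ (U)`, as `D + ι^* D` is the divisor of `U`. -/
theorem dvd_mul_conj {a b : CurveRing f} (ha : a ∈ D.ideal) (hb : b ∈ D.ideal) :
    ofPoly f D.U ∣ a * conj f b := by
  obtain ⟨a₁, a₂, rfl⟩ := Ideal.mem_span_pair.1 ha
  obtain ⟨b₁, b₂, rfl⟩ := Ideal.mem_span_pair.1 hb
  refine ⟨a₁ * conj f b₁ * ofPoly f D.U - a₁ * conj f b₂ * (y f + ofPoly f D.R)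
    + a₂ * conj f b₁ * (y f - ofPoly f D.R) - a₂ * conj f b₂ * ofPoly f D.V, ?_⟩
  simp only [map_add, map_mul, map_sub, conj_ofPoly, conj_y]
  linear_combination (-(a₂ * conj f b₂)) * D.ofPoly_V_eq

/-- The function `a · ι(b) / U`, for sections `a`, `b` of `𝒪(-D)`: the isomorphism
`𝒪(-D) ⊗ 𝒪(-ι^* D) ≅ 𝒪` that sends `U` to `1`, applied to `a ⊗ ι(b)`. -/
noncomputable def divU (a b : D.ideal) : CurveRing f :=
  Classical.choose (D.dvd_mul_conj a.2 b.2)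

theorem divU_spec (a b : D.ideal) :
    (a : CurveRing f) * conj f b = ofPoly f D.U * D.divU a b :=
  Classical.choose_spec (D.dvd_mul_conj a.2 b.2)

theorem divU_eq {a b : D.ideal} {c : CurveRing f}
    (h : (a : CurveRing f) * conj f b = ofPoly f D.U * c) : D.divU a b = c :=
  ofPoly_mul_cancel f D.monic_U.ne_zero (by rw [← divU_spec, h])

/-- The pairing `(a, b) ↦ a · ι(b) / U mod y` on sections of `𝒪(-D)`, with values in `A_f`. -/
noncomputable def pairingIdeal : D.ideal →ₗ[k] D.ideal →ₗ[k] AdjoinRoot f :=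
  LinearMap.mk₂ k (fun a b => modY f (D.divU a b))
    (fun a a' b => by
      rw [← map_add]; congr 1; apply D.divU_eq
      rw [mul_add, ← divU_spec, ← divU_spec, Submodule.coe_add, add_mul])
    (fun c a b => by
      rw [← modY_smul]; congr 1; apply D.divU_eq
      rw [mul_smul_comm, ← divU_spec, Submodule.coe_smul_of_tower, smul_mul_assoc])
    (fun a b b' => by
      rw [← map_add]; congr 1; apply D.divU_eq
      rw [mul_add, ← divU_spec, ← divU_spec, Submodule.coe_add, map_add, mul_add])
    (fun c a b => by
      rw [← modY_smul]; congr 1; apply D.divU_eq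
      rw [mul_smul_comm, ← divU_spec, Submodule.coe_smul_of_tower, conj_smul, mul_smul_comm])

theorem pairingIdeal_apply (a b : D.ideal) :
    D.pairingIdeal a b = modY f (D.divU a b) := rfl

theorem mem_yMul {a : D.ideal} (ha : a ∈ D.yMul) : ∃ b : D.ideal, a = y f • b := by
  rw [yMul, Submodule.ideal_span_singleton_smul, Submodule.mem_smul_pointwise_iff_exists] at ha
  obtain ⟨b, -, hb⟩ := ha
  exact ⟨b, hb.symm⟩

theorem pairingIdeal_left {a : D.ideal} (ha : a ∈ D.yMul) (b : D.ideal) :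
    D.pairingIdeal a b = 0 := by
  obtain ⟨c, rfl⟩ := D.mem_yMul ha
  have h : D.divU (y f • c) b = y f * D.divU c b := by
    apply D.divU_eq
    rw [Submodule.coe_smul, smul_eq_mul, mul_assoc, divU_spec]
    ring
  rw [pairingIdeal_apply, h, map_mul, modY_y, zero_mul]

theorem pairingIdeal_right (a : D.ideal) {b : D.ideal} (hb : b ∈ D.yMul) :
    D.pairingIdeal a b = 0 := by
  obtain ⟨c, rfl⟩ := D.mem_yMul hb
  have h : D.divU a (y f • c) = -y f * D.divU a c := by
    apply D.divU_eq
    rw [Submodule.coe_smul, smul_eq_mul, map_mul, conj_y, mul_left_comm, divU_spec]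
    ring
  rw [pairingIdeal_apply, h, map_mul, map_neg, modY_y, neg_zero, zero_mul]

/-- The isomorphism `φ_D : W_D ⊗ W_D ≅ A_f`, as a bilinear map on `W_D` with values in
`A_f = k[x] / (f)`: it sends the classes of `a` and `b` to `a · ι(b) / U mod y`. -/
noncomputable def phi : D.W →ₗ[k] D.W →ₗ[k] AdjoinRoot f :=
  LinearMap.mk₂ k
    (fun v w => Quotient.liftOn₂' v w (fun a b => D.pairingIdeal a b) (by
      intro a b a' b' ha hb
      have ha' : a - a' ∈ D.yMul := (Submodule.quotientRel_def _).1 ha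
      have hb' : b - b' ∈ D.yMul := (Submodule.quotientRel_def _).1 hb
      have h1 := D.pairingIdeal_left ha' b
      have h2 := D.pairingIdeal_right a' hb'
      rw [map_sub, LinearMap.sub_apply, sub_eq_zero] at h1
      rw [map_sub, sub_eq_zero] at h2
      exact h1.trans h2))
    (by rintro ⟨a⟩ ⟨a'⟩ ⟨b⟩; exact LinearMap.map_add₂ D.pairingIdeal a a' b)
    (by rintro c ⟨a⟩ ⟨b⟩; exact LinearMap.map_smul₂ D.pairingIdeal c a b)
    (by rintro ⟨a⟩ ⟨b⟩ ⟨b'⟩; exact map_add (D.pairingIdeal a) b b')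
    (by rintro c ⟨a⟩ ⟨b⟩; exact map_smul (D.pairingIdeal a) c b)

theorem phi_toW (a b : D.ideal) : D.phi (D.toW a) (D.toW b) = modY f (D.divU a b) := rfl

/-- The bilinear form of the quadratic space `W_D`:
`(v, w)_{W_D} = (-1) ^ deg U · τ(φ_D(v ⊗ w))`. -/
noncomputable def form : LinearMap.BilinForm k D.W :=
  ((-1 : k) ^ D.U.natDegree) • D.phi.compr₂ (tauForm g D.monic_f)

end MumfordTriple

/-- A `ℤ`-lattice in a (finite-dimensional) quadratic space `W₀` over `ℚ` with form `B`: a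
`ℤ`-submodule generated by a `ℚ`-basis of `W₀`, on which `B` takes values in `ℤ` and induces an
isomorphism from `L` to `Hom(L, ℤ)`. -/
structure IsUnimodularZLattice {W₀ : Type*} [AddCommGroup W₀] [Module ℚ W₀] (B : LinearMap.BilinForm ℚ W₀)
    (L : Submodule ℤ W₀) : Prop where
  basis : ∃ (n : ℕ) (b : Module.Basis (Fin n) ℚ W₀), L = Submodule.span ℤ (Set.range b)
  dual : ∃ e : L ≃ₗ[ℤ] Module.Dual ℤ L, ∀ v w : L, ((e v w : ℤ) : ℚ) = B v w

/-- `v` is a primitive vector of `L`: it lies in `L` and is not a proper multiple of a vector of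
`L`. -/
def IsPrimitiveVector {W₀ : Type*} [AddCommGroup W₀] (L : Submodule ℤ W₀) (v : W₀) : Prop :=
  v ∈ L ∧ ∀ n : ℤ, ∀ w ∈ L, v = n • w → IsUnit n

/-- `H` is the inner product attached by the reduction covariant to the self-adjoint operator `T`
on the real quadratic space with form `B`. -/
structure IsReductionInner {W₀ : Type*} [AddCommGroup W₀] [Module ℝ W₀]
    (B : LinearMap.BilinForm ℝ W₀) (T : W₀ →ₗ[ℝ] W₀) (H : LinearMap.BilinForm ℝ W₀) : Prop where
  /-- `H` is symmetric. -/
  symm : ∀ v w, H v w = H w v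
  /-- `H` is positive definite. -/
  pos : ∀ v, v ≠ 0 → 0 < H v v
  /-- `H` is compatible with `B`: if `φ_B`, `φ_H` are the maps from `W₀` to its dual given by
  `v ↦ B v` and `v ↦ H v`, then `θ = φ_H⁻¹ ∘ φ_B` is an isometry of `H`. -/
  compatible : ∃ θ : W₀ ≃ₗ[ℝ] W₀, (∀ v, H (θ v) = B v) ∧ ∀ v w, H (θ v) (θ w) = H v w
  /-- `T` commutes with its adjoint `S` with respect to `H`. -/
  normal : ∃ S : W₀ →ₗ[ℝ] W₀, LinearMap.IsAdjointPair H H T S ∧ T ∘ₗ S = S ∘ₗ T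

/-!
A section of `𝒪(-D)` on the affine curve is a function `p(x) + q(x) y` with `U ∣ p + q R`, and for
two such sections `(a, b)_{W_D} = (-1) ^ deg U τ(e)` with `U e = p p' - q q' f`
(`MumfordTriple.form_classElt`).

*The lattice.* Put `P = M U`, a primitive polynomial of `ℤ[x]`, and let `I` be the ideal of sections
with integral coefficients (`MumfordTriple.intIdeal`). By Gauss's lemma `a ι(b)` is divisible by `P`
for all `a`, `b` in `I`, so the form takes values in `M ℤ` on the image of `I` in `W_D`. The main
point is that the form divided by `M` is unimodular there. It suffices to see that it is
nondegenerate modulo every prime `p` (`isUnit_det_gram`). Since `τ` is perfect on `ℤ[x] / (f)`, this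
amounts to a statement about `I / p I`, a module over the principal ideal domain `𝔽_p[x]` with a
basis of two elements: if `c ι(b)` is divisible by `P` for all `b` in the ideal, then `c` itself
lies in the ideal. This follows from Cramer's rule, as the determinant of the basis is `P` up to
a unit (`MumfordTriple.IsLeastMultiple.exists_generators`), and it yields
`MumfordTriple.IsLeastMultiple.exists_of_forall_dvd_tau`.

*`M` is a square.* The basis `x ^ i U`, `x ^ j (y - R)` of `W_D` has Gram determinant `±1`
(`MumfordTriple.det_gram_stdFamily_sq`), as pole orders at infinity make the matrix anti-triangular.
The image of `I` has Gram determinant `± M ^ (2 g + 1)`. The two differ by a square, so `M = N ^ 2`,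
and the image of `I` scaled by `1 / N` is a unimodular lattice, stable under `T_D`, with `N U` as
the image of `P ∈ I`. The products `(N U, x ^ j N U)` are up to sign `τ(x ^ j P)`; as `P` is primitive,
they have no common divisor, so `N U` is a primitive vector.

*The inner product.* If `U` and `f` are coprime, the values at the points `(ω, 0)` identify
`W_D ⊗ ℂ` with a product of copies of `ℂ`, on which `T_D` is multiplication by `ω` and, by Euler's
formula for `τ` (`coeff_eq_sum_roots`), the form is `± ∑ a(ω) b(ω) / (U(ω) f'(ω))`. Therefore
`∑ a(ω) conj(b(ω)) / |U(ω) f'(ω)|` satisfies the conditions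
(`IsDiagonalization.isReductionInner_diagonalInner`). For uniqueness, an adjoint of `T_D` commuting
with `T_D` has eigenvalue `conj ω` where `T_D` has eigenvalue `ω`, which determines it; then the
involutions `θ` of two solutions differ by a positive self-adjoint polynomial in `T_D` of square `1`
(`IsDiagonalization.eq_of_isReductionInner`).
-/

/-! ### Coordinates on the curve and on `W_D` -/

namespace CurveRing

variable {k : Type*} [Field k] (f : k[X])

/-- The function `p(x) + q(x) y` on the curve. -/
noncomputable def elt (p q : k[X]) : CurveRing f := ofPoly f p + ofPoly f q * y f

theorem exists_eq_elt (a : CurveRing f) : ∃ p q : k[X], a = elt f p q := by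
  obtain ⟨h, rfl⟩ := AdjoinRoot.mk_surjective a
  induction h using Polynomial.induction_on' with
  | add h₁ h₂ ih₁ ih₂ =>
    obtain ⟨p₁, q₁, e₁⟩ := ih₁
    obtain ⟨p₂, q₂, e₂⟩ := ih₂
    refine ⟨p₁ + p₂, q₁ + q₂, ?_⟩
    rw [map_add, e₁, e₂]
    simp only [elt, map_add]
    ring
  | monomial n c =>
    induction n with
    | zero => exact ⟨c, 0, by rw [elt, map_zero, zero_mul, add_zero]; rfl⟩
    | succ n ih =>
      obtain ⟨p, q, e⟩ := ih
      refine ⟨q * f, p, ?_⟩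
      have : monomial (n + 1) c = monomial n c * (X : k[X][X]) := by
        rw [monomial_mul_X]
      rw [this, map_mul, e, AdjoinRoot.mk_X]
      change elt f p q * y f = _
      simp only [elt, map_mul]
      linear_combination (ofPoly f q) * y_sq f

end CurveRing

namespace MumfordTriple

open CurveRing

variable {k : Type*} [Field k] {g : ℕ} {f : k[X]} (D : MumfordTriple g f)

theorem natDegree_f {k : Type*} [Field k] {g : ℕ} {f : k[X]} (D : MumfordTriple g f) :
    f.natDegree = 2 * g + 1 := by
  have h : f = D.U * D.V + D.R ^ 2 := by rw [D.mul_eq]; ring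
  have hU := D.natDegree_U_le
  have hUV : (D.U * D.V).natDegree = 2 * g + 1 := by
    rw [D.monic_U.natDegree_mul D.monic_V, D.natDegree_V]
    omega
  rw [h, natDegree_add_eq_left_of_natDegree_lt, hUV]
  rw [hUV, natDegree_pow]
  by_cases hR : D.R = 0
  · simp [hR]
  · have h1 := D.degree_R_lt
    rw [degree_eq_natDegree hR, Nat.cast_lt] at h1
    omega

theorem elt_mem_ideal {p q : k[X]} (h : D.U ∣ p + q * D.R) : elt f p q ∈ D.ideal := by
  obtain ⟨s, hs⟩ := h
  refine Ideal.mem_span_pair.2 ⟨ofPoly f s, ofPoly f q, ?_⟩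
  have := congrArg (ofPoly f) hs
  simp only [map_add, map_mul] at this
  simp only [elt]
  linear_combination -this

theorem exists_eq_elt_of_mem_ideal {a : CurveRing f} (ha : a ∈ D.ideal) :
    ∃ p q : k[X], D.U ∣ p + q * D.R ∧ a = elt f p q := by
  obtain ⟨b, c, rfl⟩ := Ideal.mem_span_pair.1 ha
  obtain ⟨p₁, q₁, rfl⟩ := exists_eq_elt f b
  obtain ⟨p₂, q₂, rfl⟩ := exists_eq_elt f c
  refine ⟨p₁ * D.U + (q₂ * f - p₂ * D.R), q₁ * D.U + (p₂ - q₂ * D.R),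
    ⟨p₁ + q₁ * D.R + q₂ * D.V, ?_⟩, ?_⟩
  · linear_combination -q₂ * D.mul_eq
  · simp only [elt, map_add, map_sub, map_mul]
    linear_combination (ofPoly f q₂) * y_sq f

/-- The class in `W_D` of the section `p(x) + q(x) y` of `𝒪(-D)`. -/
noncomputable def classElt (p q : k[X]) (h : D.U ∣ p + q * D.R) : D.W :=
  D.toW ⟨elt f p q, D.elt_mem_ideal h⟩

theorem classElt_congr {p q p' q' : k[X]} (h : D.U ∣ p + q * D.R) (hp : p = p') (hq : q = q') :
    D.classElt p q h = D.classElt p' q' (hp ▸ hq ▸ h) := by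
  subst hp hq; rfl

theorem exists_eq_classElt (v : D.W) : ∃ p q h, v = D.classElt p q h := by
  obtain ⟨⟨a, ha⟩, rfl⟩ := Submodule.mkQ_surjective _ v
  obtain ⟨p, q, h, rfl⟩ := D.exists_eq_elt_of_mem_ideal ha
  exact ⟨p, q, h, rfl⟩

theorem dvd_add_pair {p q p' q' : k[X]} (h : D.U ∣ p + q * D.R) (h' : D.U ∣ p' + q' * D.R) :
    D.U ∣ (p + p') + (q + q') * D.R := by
  have := dvd_add h h'
  convert this using 1
  ring

theorem dvd_mul_pair (r : k[X]) {p q : k[X]} (h : D.U ∣ p + q * D.R) :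
    D.U ∣ r * p + (r * q) * D.R := by
  have := h.mul_left r
  convert this using 1
  ring

theorem classElt_add {p q p' q' : k[X]} (h : D.U ∣ p + q * D.R) (h' : D.U ∣ p' + q' * D.R) :
    D.classElt (p + p') (q + q') (D.dvd_add_pair h h')
      = D.classElt p q h + D.classElt p' q' h' := by
  rw [classElt, classElt, classElt, ← map_add]
  congr 1
  ext
  simp only [elt, map_add, Submodule.coe_add]
  ring

theorem classElt_mul (r : k[X]) {p q : k[X]} (h : D.U ∣ p + q * D.R) :
    D.classElt (r * p) (r * q) (D.dvd_mul_pair r h) = ofPoly f r • D.classElt p q h := by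
  rw [classElt, classElt, ← map_smul]
  congr 1
  ext
  simp only [elt, map_mul, Submodule.coe_smul, smul_eq_mul]
  ring

theorem dvd_y_pair {p q : k[X]} (h : D.U ∣ p + q * D.R) : D.U ∣ q * f + p * D.R := by
  have h1 : q * f + p * D.R = D.U * (q * D.V) + (p + q * D.R) * D.R := by
    linear_combination -q * D.mul_eq
  rw [h1]
  exact dvd_add (dvd_mul_right _ _) (h.mul_right _)

theorem classElt_y {p q : k[X]} (h : D.U ∣ p + q * D.R) :
    D.classElt (q * f) p (D.dvd_y_pair h) = 0 := by
  have : (⟨elt f (q * f) p, D.elt_mem_ideal (D.dvd_y_pair h)⟩ : D.ideal)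
      = y f • ⟨elt f p q, D.elt_mem_ideal h⟩ := by
    ext
    simp only [elt, map_mul, Submodule.coe_smul, smul_eq_mul]
    linear_combination -(ofPoly f q) * y_sq f
  rw [classElt, this]
  refine (Submodule.Quotient.mk_eq_zero _).2 ?_
  exact Submodule.smul_mem_smul (Ideal.mem_span_singleton_self _) Submodule.mem_top

theorem ofPoly_C_smul (c : k) (v : D.W) : ofPoly f (C c) • v = c • v := by
  have h := smul_assoc c (1 : CurveRing f) v
  rwa [smul_eq, mul_one, one_smul] at h

theorem T_apply (v : D.W) : D.T v = ofPoly f X • v := rfl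

theorem f_smul (v : D.W) : ofPoly f f • v = 0 := by
  obtain ⟨p, q, h, rfl⟩ := D.exists_eq_classElt v
  rw [← D.classElt_mul]
  have := D.classElt_y (D.dvd_y_pair h)
  rw [D.classElt_congr _ (by ring : f * p = p * f) (by ring : f * q = q * f)]
  exact this

theorem tauForm_mk {hf : f.Monic} (e : k[X]) :
    tauForm g hf (AdjoinRoot.mk f e) = (e %ₘ f).coeff (2 * g) := by
  simp [tauForm]

theorem phi_classElt {p q p' q' e : k[X]} (h : D.U ∣ p + q * D.R) (h' : D.U ∣ p' + q' * D.R)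
    (he : p * p' - q * q' * f = D.U * e) :
    D.phi (D.classElt p q h) (D.classElt p' q' h') = AdjoinRoot.mk f e := by
  have h2 : D.U ∣ q * p' - p * q' := by
    have : q * p' - p * q' = q * (p' + q' * D.R) - q' * (p + q * D.R) := by ring
    rw [this]
    exact dvd_sub (h'.mul_left _) (h.mul_left _)
  obtain ⟨e', he'⟩ := h2
  rw [classElt, classElt, phi_toW, D.divU_eq (c := elt f e e')]
  · simp [elt]
  · have e1 := congrArg (ofPoly f) he
    have e2 := congrArg (ofPoly f) he'
    simp only [map_sub, map_mul] at e1 e2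
    simp only [elt, map_add, map_mul, conj_ofPoly, conj_y]
    linear_combination e1 + e2 * y f - ofPoly f q * ofPoly f q' * y_sq f

theorem dvd_norm_pair {p q p' q' : k[X]} (h : D.U ∣ p + q * D.R) (h' : D.U ∣ p' + q' * D.R) :
    D.U ∣ p * p' - q * q' * f := by
  have : p * p' - q * q' * f
      = p * (p' + q' * D.R) - q' * D.R * (p + q * D.R) - D.U * (q * q' * D.V) := by
    linear_combination q * q' * D.mul_eq
  rw [this]
  exact dvd_sub (dvd_sub (h'.mul_left _) (h.mul_left _)) (dvd_mul_right _ _)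

theorem form_classElt {p q p' q' e : k[X]} (h : D.U ∣ p + q * D.R) (h' : D.U ∣ p' + q' * D.R)
    (he : p * p' - q * q' * f = D.U * e) :
    D.form (D.classElt p q h) (D.classElt p' q' h')
      = (-1) ^ D.U.natDegree * (e %ₘ f).coeff (2 * g) := by
  rw [form, LinearMap.smul_apply, LinearMap.smul_apply, LinearMap.compr₂_apply,
    D.phi_classElt h h' he, tauForm_mk, smul_eq_mul]

theorem form_symm (v w : D.W) : D.form v w = D.form w v := by
  obtain ⟨p, q, h, rfl⟩ := D.exists_eq_classElt v
  obtain ⟨p', q', h', rfl⟩ := D.exists_eq_classElt w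
  obtain ⟨e, he⟩ := D.dvd_norm_pair h h'
  rw [D.form_classElt h h' he, D.form_classElt h' h (e := e) (by rw [← he]; ring)]

theorem form_T (v w : D.W) : D.form (D.T v) w = D.form v (D.T w) := by
  obtain ⟨p, q, h, rfl⟩ := D.exists_eq_classElt v
  obtain ⟨p', q', h', rfl⟩ := D.exists_eq_classElt w
  obtain ⟨e, he⟩ := D.dvd_norm_pair h h'
  rw [T_apply, T_apply, ← D.classElt_mul, ← D.classElt_mul,
    D.form_classElt _ _ (e := X * e) (by linear_combination X * he),
    D.form_classElt _ _ (e := X * e) (by linear_combination X * he)]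

theorem classU_eq : D.classU = D.classElt D.U 0 (by simp) := by
  rw [classU, classElt]
  congr 1
  ext
  simp [elt]

end MumfordTriple

/-! ### A criterion for unimodularity -/

section Lattice

variable {W₀ : Type*} [AddCommGroup W₀] [Module ℚ W₀]

theorem exists_basis_of_fg_of_span_eq_top {L : Submodule ℤ W₀} (hfg : L.FG)
    (hspan : Submodule.span ℚ (L : Set W₀) = ⊤) :
    ∃ (n : ℕ) (b : Module.Basis (Fin n) ℚ W₀), L = Submodule.span ℤ (Set.range b) := by
  have : Module.Finite ℤ L := Module.Finite.iff_fg.2 hfg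
  have : Module.IsTorsionFree ℤ W₀ := Module.IsTorsionFree.trans_faithfulSMul ℤ ℚ W₀
  let c := Module.finBasis ℤ L
  have hL : L = Submodule.span ℤ (Set.range fun i => (c i : W₀)) := by
    have h := congrArg (Submodule.map L.subtype) c.span_eq
    rw [Submodule.map_span, Submodule.map_top, Submodule.range_subtype, ← Set.range_comp] at h
    exact h.symm
  have hli : LinearIndependent ℤ fun i => (c i : W₀) :=
    c.linearIndependent.map' L.subtype L.ker_subtype
  rw [LinearIndependent.iff_fractionRing ℤ ℚ] at hli
  have hb : Submodule.span ℚ (Set.range fun i => (c i : W₀)) = ⊤ := by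
    rw [eq_top_iff, ← hspan, Submodule.span_le]
    intro v hv
    rw [SetLike.mem_coe, hL] at hv
    exact Submodule.span_le_restrictScalars ℤ ℚ _ hv
  refine ⟨_, Module.Basis.mk hli hb.ge, ?_⟩
  rw [Module.Basis.coe_mk]
  exact hL

/-- A Gram matrix of an integral form with determinant divisible by `p` has a kernel vector modulo
`p`; it lifts to a vector of the lattice which pairs into `p ℤ` with all of the lattice. -/
theorem isUnit_det_gram {n : ℕ} {B : LinearMap.BilinForm ℚ W₀} {L : Submodule ℤ W₀}
    (b : Module.Basis (Fin n) ℚ W₀) (hL : L = Submodule.span ℤ (Set.range b))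
    {G : Matrix (Fin n) (Fin n) ℤ} (hG : ∀ i j, B (b i) (b j) = G i j)
    (hp : ∀ p : ℕ, p.Prime → ∀ v ∈ L, (∀ w ∈ L, ∃ z : ℤ, B v w = p * z) →
      ∃ v' ∈ L, v = (p : ℤ) • v') : IsUnit G.det := by
  by_contra hdet
  rw [Int.isUnit_iff_natAbs_eq] at hdet
  obtain ⟨p, hpp, hpd⟩ := Nat.exists_prime_and_dvd hdet
  have : Fact p.Prime := ⟨hpp⟩
  have hdet0 : (G.map (Int.castRingHom (ZMod p))).det = 0 := by
    have h1 : (Int.castRingHom (ZMod p)) G.det = (G.map (Int.castRingHom (ZMod p))).det := by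
      rw [RingHom.map_det]; rfl
    rw [← h1, eq_intCast, ZMod.intCast_zmod_eq_zero_iff_dvd]
    exact Int.natCast_dvd.2 hpd
  obtain ⟨u, hu0, hu⟩ := Matrix.exists_vecMul_eq_zero_iff.2 hdet0
  choose a ha using fun i => ZMod.intCast_surjective (u i)
  have hmem : ∀ c : Fin n → ℤ, ∑ i, c i • b i ∈ L := fun c => by
    rw [hL]
    exact Submodule.sum_mem _ fun i _ => Submodule.smul_mem _ _ (Submodule.subset_span ⟨i, rfl⟩)
  have hex : ∀ v ∈ L, ∃ c : Fin n → ℤ, v = ∑ i, c i • b i := fun v hv => by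
    rw [hL] at hv
    obtain ⟨c, hc⟩ := (Submodule.mem_span_range_iff_exists_fun ℤ).1 hv
    exact ⟨c, hc.symm⟩
  obtain ⟨v', hv', e⟩ := hp p hpp _ (hmem a) (by
    intro w hw
    obtain ⟨c, rfl⟩ := hex w hw
    have hdvd : ∀ j, ∃ z : ℤ, ∑ i, a i * G i j = p * z := fun j => by
      have := congrFun hu j
      simp only [Matrix.vecMul, dotProduct, Matrix.map_apply, Pi.zero_apply, ← ha,
        eq_intCast] at this
      norm_cast at this
      rw [ZMod.intCast_zmod_eq_zero_iff_dvd] at this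
      exact this
    choose z hz using hdvd
    refine ⟨∑ j, c j * z j, ?_⟩
    have : B (∑ i, a i • b i) (∑ j, c j • b j) = ((∑ j, c j * ∑ i, a i * G i j : ℤ) : ℚ) := by
      simp only [map_sum, LinearMap.sum_apply, map_zsmul, LinearMap.smul_apply, zsmul_eq_mul,
        Finset.mul_sum, hG]
      push_cast
      rw [Finset.sum_comm]
    rw [this]
    simp only [hz]
    push_cast
    rw [Finset.mul_sum]
    exact Finset.sum_congr rfl fun j _ => by ring)
  obtain ⟨d, rfl⟩ := hex v' hv'
  apply hu0
  ext i
  have hi := congrArg (fun x => b.repr x i) e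
  simp only [map_sum, map_zsmul, Finset.smul_sum, Module.Basis.repr_self, Finsupp.coe_finsetSum,
    Finset.sum_apply, Finsupp.smul_apply, Finsupp.single_apply, zsmul_eq_mul, mul_ite, mul_one,
    mul_zero, Finset.sum_ite_eq', Finset.mem_univ, if_true] at hi
  norm_cast at hi
  rw [← ha i, hi]
  simp

/-- A lattice whose Gram matrix in some basis has unit determinant is self-dual. -/
theorem isUnimodularZLattice_of_isUnit_det {n : ℕ} {B : LinearMap.BilinForm ℚ W₀}
    {L : Submodule ℤ W₀} (b : Module.Basis (Fin n) ℚ W₀)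
    (hL : L = Submodule.span ℤ (Set.range b)) {G : Matrix (Fin n) (Fin n) ℤ}
    (hG : ∀ i j, B (b i) (b j) = G i j) (hdet : IsUnit G.det) : IsUnimodularZLattice B L := by
  refine ⟨⟨n, b, hL⟩, ?_⟩
  subst hL
  have hli : LinearIndependent ℤ b := by
    rw [LinearIndependent.iff_fractionRing ℤ ℚ]
    exact b.linearIndependent
  let c : Module.Basis (Fin n) ℤ (Submodule.span ℤ (Set.range b)) := Module.Basis.span hli
  have hc : ∀ i, (c i : W₀) = b i := fun i => congrArg Subtype.val (Module.Basis.span_apply hli i)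
  let φ : Submodule.span ℤ (Set.range b) →ₗ[ℤ] Module.Dual ℤ (Submodule.span ℤ (Set.range b)) :=
    c.constr ℤ fun i => c.constr ℤ fun j => G i j
  have hφ : ∀ i j, φ (c i) (c j) = G i j := fun i j => by
    simp [φ]
  have hmat : LinearMap.toMatrix c c.dualBasis φ = G.transpose := by
    ext i j
    rw [LinearMap.toMatrix_apply, Matrix.transpose_apply, Module.Basis.dualBasis_repr, hφ]
  have hdet' : IsUnit (LinearMap.toMatrix c c.dualBasis φ).det := by
    rwa [hmat, Matrix.det_transpose]
  refine ⟨LinearEquiv.ofIsUnitDet hdet', fun v w => ?_⟩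
  rw [LinearEquiv.ofIsUnitDet_apply]
  rw [← c.sum_repr v, ← c.sum_repr w]
  simp only [map_sum, LinearMap.sum_apply, map_smul, LinearMap.smul_apply, hφ,
    AddSubmonoidClass.coe_finsetSum, Submodule.coe_smul, hc, zsmul_eq_mul, hG, smul_eq_mul,
    map_zsmul]
  push_cast
  rfl

end Lattice

/-! ### The integral ideal -/

theorem exists_map_eq_C_mul (q : ℚ[X]) :
    ∃ (k : ℤ) (Q : ℤ[X]), k ≠ 0 ∧ Q.map (Int.castRingHom ℚ) = C (k : ℚ) * q := by
  obtain ⟨k, hk, h⟩ := IsLocalization.integerNormalization_spec (nonZeroDivisors ℤ) q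
  refine ⟨k, IsLocalization.integerNormalization (nonZeroDivisors ℤ) q,
    nonZeroDivisors.ne_zero hk, ?_⟩
  have h' : (IsLocalization.integerNormalization (nonZeroDivisors ℤ) q).map (Int.castRingHom ℚ)
      = k • q := h
  rw [h']
  ext i
  simp

theorem exists_eq_C_mul_of_map_zmod_eq_zero (p : ℕ) {q : ℤ[X]}
    (h : q.map (Int.castRingHom (ZMod p)) = 0) : ∃ c, q = C (p : ℤ) * c := by
  refine (C_dvd_iff_dvd_coeff _ _).2 fun i => ?_
  have := congrArg (fun q => q.coeff i) h
  simpa [coeff_map, ZMod.intCast_zmod_eq_zero_iff_dvd] using this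

namespace MumfordTriple

variable {g : ℕ} {f : ℤ[X]} (D : MumfordTriple g (f.map (Int.castRingHom ℚ)))

/-- The pairs `(p, q)` of integral polynomials such that the function `p(x) + q(x) y` lies in
`H⁰(C_f⁰, 𝒪(-D))`. -/
noncomputable def intIdeal : Submodule ℤ[X] (ℤ[X] × ℤ[X]) where
  carrier := {a | D.U ∣ a.1.map (Int.castRingHom ℚ) + a.2.map (Int.castRingHom ℚ) * D.R}
  add_mem' {a b} ha hb := by
    simpa only [Set.mem_ofPred_eq, Prod.fst_add, Prod.snd_add, Polynomial.map_add] using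
      D.dvd_add_pair ha hb
  zero_mem' := by simp
  smul_mem' r a ha := by
    simpa only [Set.mem_ofPred_eq, Prod.smul_fst, Prod.smul_snd, smul_eq_mul, Polynomial.map_mul]
      using D.dvd_mul_pair (r.map (Int.castRingHom ℚ)) ha

theorem mem_intIdeal {a : ℤ[X] × ℤ[X]} : a ∈ D.intIdeal ↔
    D.U ∣ a.1.map (Int.castRingHom ℚ) + a.2.map (Int.castRingHom ℚ) * D.R := Iff.rfl

theorem y_mem_intIdeal {a : ℤ[X] × ℤ[X]} (ha : a ∈ D.intIdeal) :
    (a.2 * f, a.1) ∈ D.intIdeal := by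
  rw [mem_intIdeal, Polynomial.map_mul]
  exact D.dvd_y_pair ha

theorem mem_intIdeal_of_smul_mem {n : ℤ} (hn : n ≠ 0) {a : ℤ[X] × ℤ[X]}
    (ha : (C n : ℤ[X]) • a ∈ D.intIdeal) : a ∈ D.intIdeal := by
  rw [mem_intIdeal] at ha ⊢
  have hu : IsUnit (C (n : ℚ)) := isUnit_C.2 (by simpa using hn)
  rw [← hu.dvd_mul_left]
  convert ha using 1
  simp only [Prod.smul_fst, Prod.smul_snd, smul_eq_mul, Polynomial.map_mul, map_C]
  rw [eq_intCast]
  ring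

/-- A section of the form `S + k y` with `k` a nonzero integer, a multiple of `y - R`. -/
theorem exists_const_mem_intIdeal :
    ∃ (k : ℤ) (S : ℤ[X]), k ≠ 0 ∧ (S, C k) ∈ D.intIdeal := by
  obtain ⟨k, S, hk, hS⟩ := exists_map_eq_C_mul D.R
  refine ⟨k, -S, hk, ?_⟩
  rw [mem_intIdeal, Polynomial.map_neg, hS, map_C, eq_intCast]
  simp

/-- `P = M U` is integral, for the least positive integer `M` for which this is the case. -/
structure IsLeastMultiple (M : ℕ) (P : ℤ[X]) : Prop where
  map_eq : P.map (Int.castRingHom ℚ) = C (M : ℚ) * D.U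
  isLeast : IsLeast {m : ℕ | 0 < m ∧ ∃ Q : ℤ[X], Q.map (Int.castRingHom ℚ) = C (m : ℚ) * D.U} M

variable {D} {M : ℕ} {P : ℤ[X]}

namespace IsLeastMultiple

theorem pos (h : D.IsLeastMultiple M P) : 0 < M := h.isLeast.1.1

theorem isPrimitive (h : D.IsLeastMultiple M P) : P.IsPrimitive := by
  intro r hr
  obtain ⟨Q, rfl⟩ := hr
  have h1 := h.map_eq
  have hlead := congrArg leadingCoeff h1
  rw [leadingCoeff_mul, D.monic_U.leadingCoeff, mul_one, leadingCoeff_C,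
    leadingCoeff_map_of_injective (RingHom.injective_int _), leadingCoeff_mul, leadingCoeff_C,
    eq_intCast] at hlead
  norm_cast at hlead
  have hM := h.pos
  have hr0 : r ≠ 0 := by rintro rfl; simp at hlead; omega
  have hdvd : r.natAbs ∣ M := Int.natAbs_dvd_natAbs.2 ⟨_, hlead.symm⟩
  obtain ⟨m, hm⟩ := hdvd
  have hm0 : 0 < m := Nat.pos_of_ne_zero (by rintro rfl; omega)
  have hle : M ≤ m := h.isLeast.2 ⟨hm0, C (r.sign) * Q, by
    have hr0' : (C (r.natAbs : ℚ)) ≠ 0 := by simpa using hr0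
    apply mul_left_cancel₀ hr0'
    rw [hm, Polynomial.map_mul, map_C] at h1
    rw [Polynomial.map_mul, map_C, ← mul_assoc, ← mul_assoc, ← C_mul, ← C_mul]
    have e : ((r.natAbs : ℚ)) * (Int.castRingHom ℚ r.sign) = Int.castRingHom ℚ r := by
      rw [eq_intCast, eq_intCast]
      have := Int.sign_mul_natAbs r
      rw [mul_comm]
      rw [← Int.cast_natCast, ← Int.cast_mul, this]
    rw [e, h1]
    push_cast
    rfl⟩
  have : r.natAbs = 1 := by
    have := Nat.pos_of_ne_zero (Int.natAbs_ne_zero.2 hr0)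
    nlinarith
  exact Int.isUnit_iff_natAbs_eq.2 this

theorem ne_zero (h : D.IsLeastMultiple M P) : P ≠ 0 := h.isPrimitive.ne_zero

theorem sqrt_ne_zero (h : D.IsLeastMultiple M P) {N : ℕ} (hN : M = N ^ 2) : (N : ℚ) ≠ 0 := by
  have := h.pos
  rw [Nat.cast_ne_zero]
  rintro rfl
  simp at hN
  omega

/-- Gauss's lemma: divisibility by `U` over `ℚ` is divisibility by `P` over `ℤ`. -/
theorem dvd_of_dvd_map (h : D.IsLeastMultiple M P) {q : ℤ[X]}
    (hq : D.U ∣ q.map (Int.castRingHom ℚ)) : P ∣ q := by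
  rw [IsPrimitive.Int.dvd_iff_map_cast_dvd_map_cast _ _ h.isPrimitive, h.map_eq]
  have hu : IsUnit (C (M : ℚ)) := isUnit_C.2 (by simpa using h.pos.ne')
  rwa [hu.mul_left_dvd]

/-- `a.1 * b.1 - a.2 * b.2 * f` is the part of `a ι(b)` which is a polynomial in `x`. -/
theorem dvd_norm (h : D.IsLeastMultiple M P) {a b : ℤ[X] × ℤ[X]} (ha : a ∈ D.intIdeal)
    (hb : b ∈ D.intIdeal) : P ∣ a.1 * b.1 - a.2 * b.2 * f := by
  apply h.dvd_of_dvd_map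
  simpa only [Polynomial.map_sub, Polynomial.map_mul] using D.dvd_norm_pair ha hb

/-- `a.1 * b.2 - a.2 * b.1` is the determinant of the pair `a`, `b` over `ℤ[x]`, and up to sign the
`y`-coefficient of `a ι(b)`. -/
theorem dvd_det (h : D.IsLeastMultiple M P) {a b : ℤ[X] × ℤ[X]} (ha : a ∈ D.intIdeal)
    (hb : b ∈ D.intIdeal) : P ∣ a.1 * b.2 - a.2 * b.1 := by
  apply h.dvd_of_dvd_map
  rw [mem_intIdeal] at ha hb
  rw [Polynomial.map_sub, Polynomial.map_mul, Polynomial.map_mul]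
  convert dvd_sub (ha.mul_left (b.2.map (Int.castRingHom ℚ)))
    (hb.mul_left (a.2.map (Int.castRingHom ℚ))) using 1
  ring

theorem mem_intIdeal (h : D.IsLeastMultiple M P) : (P, 0) ∈ D.intIdeal := by
  rw [MumfordTriple.mem_intIdeal, h.map_eq]
  simp

theorem map_zmod_ne_zero (h : D.IsLeastMultiple M P) (p : ℕ) [hp : Fact p.Prime] :
    P.map (Int.castRingHom (ZMod p)) ≠ 0 := by
  intro h0
  have h1 := h.isPrimitive _ (exists_eq_C_mul_of_map_zmod_eq_zero p h0)
  exact (Nat.prime_iff_prime_int.1 hp.out).not_isUnit h1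

end IsLeastMultiple

end MumfordTriple

/-! ### Reduction of the integral ideal modulo a prime -/

theorem map_zmod_surjective (p : ℕ) :
    Function.Surjective (Polynomial.map (Int.castRingHom (ZMod p))) :=
  Polynomial.map_surjective _ ZMod.intCast_surjective

/-- If `x ^ i h` has no coefficient of degree `deg f - 1` modulo `f` for all `i`, then `f ∣ h`: the
form `τ` is perfect. -/
theorem dvd_of_forall_coeff_modByMonic_eq_zero {k : Type*} [Field k] {f h : k[X]} {n : ℕ}
    (hf : f.Monic) (hn : f.natDegree = n + 1)
    (h0 : ∀ i : ℕ, ((X ^ i * h) %ₘ f).coeff n = 0) : f ∣ h := by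
  rw [← modByMonic_eq_zero_iff_dvd hf]
  by_contra hr
  set r := h %ₘ f with hr_def
  have hf1 : f ≠ 1 := by rintro rfl; simp at hn
  have hdeg : r.natDegree ≤ n := by
    have := natDegree_modByMonic_lt h hf hf1
    rw [← hr_def] at this
    omega
  have h1 := h0 (n - r.natDegree)
  have h2 : X ^ (n - r.natDegree) * h
      = X ^ (n - r.natDegree) * r + f * (X ^ (n - r.natDegree) * (h /ₘ f)) := by
    conv_lhs => rw [← modByMonic_add_div h f]
    ring
  rw [h2, add_modByMonic, (modByMonic_eq_zero_iff_dvd hf).2 (dvd_mul_right f _), add_zero,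
    (modByMonic_eq_self_iff hf).2] at h1
  · rw [coeff_X_pow_mul', if_pos (by omega), Nat.sub_sub_self hdeg, coeff_natDegree,
      leadingCoeff_eq_zero] at h1
    exact hr h1
  · refine degree_lt_degree ?_
    rw [natDegree_X_pow_mul]
    · omega
    · exact hr

namespace MumfordTriple

variable {g : ℕ} {f : ℤ[X]} {D : MumfordTriple g (f.map (Int.castRingHom ℚ))} {M : ℕ} {P : ℤ[X]}

namespace IsLeastMultiple

theorem exists_eq_smul_of_map_zmod_eq_zero (p : ℕ) [hp : Fact p.Prime] {a : ℤ[X] × ℤ[X]}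
    (ha : a ∈ D.intIdeal) (h1 : a.1.map (Int.castRingHom (ZMod p)) = 0)
    (h2 : a.2.map (Int.castRingHom (ZMod p)) = 0) :
    ∃ c ∈ D.intIdeal, a = (C (p : ℤ) : ℤ[X]) • c := by
  obtain ⟨c₁, e₁⟩ := exists_eq_C_mul_of_map_zmod_eq_zero p h1
  obtain ⟨c₂, e₂⟩ := exists_eq_C_mul_of_map_zmod_eq_zero p h2
  have e : a = (C (p : ℤ) : ℤ[X]) • (c₁, c₂) := Prod.ext e₁ e₂
  exact ⟨_, D.mem_intIdeal_of_smul_mem (by exact_mod_cast hp.out.ne_zero) (e ▸ ha), e⟩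

/-- The reduction of the integral ideal modulo a prime `p` is a module over the principal ideal
domain `𝔽_p[x]` with a triangular basis. -/
theorem exists_triangular_generators (h : D.IsLeastMultiple M P) (p : ℕ) [hp : Fact p.Prime] :
    ∃ a ∈ D.intIdeal, ∃ b ∈ D.intIdeal,
      (a.1 * b.2 - a.2 * b.1).map (Int.castRingHom (ZMod p)) ≠ 0 ∧
      ∀ z ∈ D.intIdeal, ∃ s t : ℤ[X], ∃ c ∈ D.intIdeal,
        z = s • a + t • b + (C (p : ℤ) : ℤ[X]) • c := by
  let red : ℤ[X] →+* (ZMod p)[X] := mapRingHom (Int.castRingHom (ZMod p))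
  have hred : Function.Surjective red := map_zmod_surjective p
  -- second coordinates on the ideal, and first coordinates on its part with second coordinate zero
  let K : Ideal ℤ[X] := D.intIdeal.map (LinearMap.snd ℤ[X] ℤ[X] ℤ[X])
  let J : Ideal ℤ[X] := (D.intIdeal ⊓ Submodule.comap (LinearMap.snd ℤ[X] ℤ[X] ℤ[X])
    (RingHom.ker red)).map (LinearMap.fst ℤ[X] ℤ[X] ℤ[X])
  obtain ⟨-, ⟨b, hb, rfl⟩, hbgen⟩ := (Ideal.mem_map_iff_of_surjective red hred).1
    (Submodule.IsPrincipal.generator_mem (K.map red))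
  obtain ⟨-, ⟨a, ha, rfl⟩, hagen⟩ := (Ideal.mem_map_iff_of_surjective red hred).1
    (Submodule.IsPrincipal.generator_mem (J.map red))
  have ha2 : red a.2 = 0 := ha.2
  have ha : a ∈ D.intIdeal := ha.1
  change red b.2 = _ at hbgen
  change red a.1 = _ at hagen
  have hK : ∀ z ∈ D.intIdeal, red b.2 ∣ red z.2 := fun z hz => by
    rw [hbgen, ← Submodule.IsPrincipal.mem_iff_generator_dvd]
    exact Ideal.mem_map_of_mem red ⟨z, hz, rfl⟩
  have hJ : ∀ z ∈ D.intIdeal, red z.2 = 0 → red a.1 ∣ red z.1 := fun z hz hz2 => by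
    rw [hagen, ← Submodule.IsPrincipal.mem_iff_generator_dvd]
    exact Ideal.mem_map_of_mem red ⟨z, ⟨hz, hz2⟩, rfl⟩
  have hP0 : red P ≠ 0 := h.map_zmod_ne_zero p
  refine ⟨a, ha, b, hb, ?_, ?_⟩
  · change red _ ≠ 0
    rw [map_sub, map_mul, map_mul, ha2, zero_mul, sub_zero]
    refine mul_ne_zero (fun h0 => hP0 ?_) (fun h0 => hP0 ?_)
    · exact zero_dvd_iff.1 (h0 ▸ hJ (P, 0) h.mem_intIdeal (map_zero _))
    · exact zero_dvd_iff.1 (h0 ▸ hK _ (D.y_mem_intIdeal h.mem_intIdeal))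
  · intro z hz
    obtain ⟨t', ht'⟩ := hK z hz
    obtain ⟨t, rfl⟩ := hred t'
    have hz' : z - t • b ∈ D.intIdeal := Submodule.sub_mem _ hz (Submodule.smul_mem _ _ hb)
    have hz2 : red (z - t • b).2 = 0 := by
      rw [Prod.snd_sub, Prod.smul_snd, smul_eq_mul, map_sub, map_mul, ht']
      ring
    obtain ⟨s', hs'⟩ := hJ _ hz' hz2
    obtain ⟨s, rfl⟩ := hred s'
    obtain ⟨c, hc, e⟩ := exists_eq_smul_of_map_zmod_eq_zero p (a := z - t • b - s • a)
      (Submodule.sub_mem _ hz' (Submodule.smul_mem _ _ ha))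
      (by
        change red _ = 0
        rw [Prod.fst_sub, Prod.smul_fst, smul_eq_mul, map_sub, map_mul, hs']
        ring)
      (by
        change red _ = 0
        rw [Prod.snd_sub, Prod.smul_snd, smul_eq_mul, map_sub, map_mul, ha2, hz2]
        ring)
    exact ⟨s, t, c, hc, by rw [← e]; abel⟩

/-- The determinant of a basis of the integral ideal modulo `p` is `P` up to a unit. This would be
immediate if the integral ideal, which is a projective `ℤ[x]`-module, were known to be free;
instead, its generators modulo `p` are used as generators modulo a high power of `p`, and compared
with the vectors `(P, 0)` and `(S, k)`, whose determinant is `k P` for a nonzero integer `k`. -/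
theorem exists_generators (h : D.IsLeastMultiple M P) (p : ℕ) [hp : Fact p.Prime] :
    ∃ a ∈ D.intIdeal, ∃ b ∈ D.intIdeal, ∃ d : ℤ[X],
      a.1 * b.2 - a.2 * b.1 = P * d ∧ IsUnit (d.map (Int.castRingHom (ZMod p))) ∧
      ∀ z ∈ D.intIdeal, ∃ s t : ℤ[X], ∃ c ∈ D.intIdeal,
        z = s • a + t • b + (C (p : ℤ) : ℤ[X]) • c := by
  obtain ⟨a, ha, b, hb, hdet, hgen⟩ := h.exists_triangular_generators p
  obtain ⟨d, hd⟩ := h.dvd_det ha hb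
  refine ⟨a, ha, b, hb, d, hd, ?_, hgen⟩
  rw [hd, Polynomial.map_mul] at hdet
  have hd0 := right_ne_zero_of_mul hdet
  have hgen' : ∀ j : ℕ, ∀ z ∈ D.intIdeal, ∃ s t : ℤ[X], ∃ c ∈ D.intIdeal,
      z = s • a + t • b + (C (p : ℤ) ^ j : ℤ[X]) • c := by
    intro j
    induction j with
    | zero => exact fun z hz => ⟨0, 0, z, hz, by simp⟩
    | succ j ih =>
      intro z hz
      obtain ⟨s, t, c, hc, rfl⟩ := ih z hz
      obtain ⟨s', t', c', hc', rfl⟩ := hgen c hc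
      exact ⟨s + C (p : ℤ) ^ j * s', t + C (p : ℤ) ^ j * t', c', hc', by module⟩
  obtain ⟨k, S, hk0, hS⟩ := D.exists_const_mem_intIdeal
  have hpp : Prime (p : ℤ) := Nat.prime_iff_prime_int.1 hp.out
  obtain ⟨i, k', hk', rfl⟩ : ∃ (i : ℕ) (k' : ℤ), ¬ (p : ℤ) ∣ k' ∧ k = (p : ℤ) ^ i * k' := by
    have hfin : FiniteMultiplicity (p : ℤ) k :=
      Int.finiteMultiplicity_iff.2 ⟨by simpa using hp.out.ne_one, hk0⟩
    obtain ⟨k', e, hk'⟩ := hfin.exists_eq_pow_mul_and_not_dvd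
    exact ⟨_, k', hk', e⟩
  obtain ⟨s, t, c, hc, e₁⟩ := hgen' (i + 1) _ h.mem_intIdeal
  obtain ⟨s', t', c', hc', e₂⟩ := hgen' (i + 1) _ hS
  obtain ⟨w₁, hw₁⟩ := h.dvd_det h.mem_intIdeal hc'
  obtain ⟨w₂, hw₂⟩ := h.dvd_det hc hc'
  obtain ⟨w₃, hw₃⟩ := h.dvd_det hc hS
  -- the determinant of `(P, 0)` and `(S, k)`, computed modulo `p ^ (i + 1)`
  have key : C (p : ℤ) ^ i * (C k' - C (p : ℤ) * (w₁ - C (p : ℤ) ^ (i + 1) * w₂ + w₃))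
      = (s * t' - t * s') * d := by
    apply mul_left_cancel₀ h.ne_zero
    simp only [Prod.ext_iff, Prod.fst_add, Prod.snd_add, Prod.smul_fst, Prod.smul_snd,
      smul_eq_mul] at e₁ e₂
    obtain ⟨e₁, e₁'⟩ := e₁
    obtain ⟨e₂, e₂'⟩ := e₂
    rw [C_mul, C_pow] at e₂'
    simp only [C_mul, C_pow] at hw₃
    set π : ℤ[X] := C (p : ℤ)
    linear_combination e₁ * (π ^ i * C k' - π ^ (i + 1) * c'.2) + (s * a.1 + t * b.1) * e₂'
      - e₁' * (S - π ^ (i + 1) * c'.1) - (s * a.2 + t * b.2) * e₂ + π ^ (i + 1) * hw₁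
      + π ^ (i + 1) * hw₃ - π ^ (2 * i + 2) * hw₂ + (s * t' - t * s') * hd
  have hCp : Prime (C (p : ℤ)) := prime_C_iff.2 hpp
  have hpd : ¬ C (p : ℤ) ∣ d := by
    rintro ⟨d', rfl⟩
    simp at hd0
  obtain ⟨e, he⟩ := hCp.pow_dvd_of_dvd_mul_right i hpd (Dvd.intro _ key)
  rw [he, mul_assoc] at key
  have key' := mul_left_cancel₀ (pow_ne_zero i hCp.ne_zero) key
  have hk'' : ((k' : ℤ) : ZMod p) ≠ 0 := by
    rwa [Ne, ZMod.intCast_zmod_eq_zero_iff_dvd]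
  have := congrArg (Polynomial.map (Int.castRingHom (ZMod p))) key'
  have hp0 : (C (p : ℤ)).map (Int.castRingHom (ZMod p)) = 0 := by simp
  rw [Polynomial.map_sub, Polynomial.map_mul, Polynomial.map_mul, hp0, zero_mul, sub_zero,
    map_C, eq_intCast] at this
  exact isUnit_of_mul_isUnit_right (this ▸ isUnit_C.2 (isUnit_iff_ne_zero.2 hk''))

/-- The integral pairing `τ(a ι(b) / P mod y)` is nondegenerate modulo every prime `p`: if `a` pairs
into `p ℤ` with the integral ideal, then modulo `p` it is `y` times a section `c` in that ideal. -/
theorem exists_of_forall_dvd_tau (h : D.IsLeastMultiple M P) (hf : f.Monic)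
    (hdeg : f.natDegree = 2 * g + 1) (p : ℕ) [hp : Fact p.Prime] {a : ℤ[X] × ℤ[X]}
    (ha : a ∈ D.intIdeal)
    (hτ : ∀ b ∈ D.intIdeal, ∀ e, a.1 * b.1 - a.2 * b.2 * f = P * e →
      (p : ℤ) ∣ (e %ₘ f).coeff (2 * g)) :
    ∃ c ∈ D.intIdeal, ∃ a' ∈ D.intIdeal, a = (c.2 * f, c.1) + (C (p : ℤ) : ℤ[X]) • a' := by
  let red : ℤ[X] →+* (ZMod p)[X] := mapRingHom (Int.castRingHom (ZMod p))
  have hred : Function.Surjective red := map_zmod_surjective p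
  have hP0 : red P ≠ 0 := h.map_zmod_ne_zero p
  have hf' : (red f).Monic := hf.map _
  have hf0 : red f ≠ 0 := hf'.ne_zero
  have hdvd : ∀ b ∈ D.intIdeal, ∀ e, a.1 * b.1 - a.2 * b.2 * f = P * e → red f ∣ red e := by
    intro b hb e he
    refine dvd_of_forall_coeff_modByMonic_eq_zero (n := 2 * g) hf'
      (by rw [← hdeg]; exact hf.natDegree_map _) fun i => ?_
    have := hτ ((X ^ i : ℤ[X]) • b) (Submodule.smul_mem _ _ hb) (X ^ i * e) (by
      simp only [Prod.smul_fst, Prod.smul_snd, smul_eq_mul]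
      linear_combination X ^ i * he)
    rw [← ZMod.intCast_zmod_eq_zero_iff_dvd, ← eq_intCast (Int.castRingHom (ZMod p)),
      ← coeff_map, map_modByMonic _ hf, Polynomial.map_mul, Polynomial.map_pow, map_X] at this
    exact this
  -- pairing with `P` shows that `a` is divisible by `y` modulo `p`
  obtain ⟨c₂', hc₂'⟩ := hdvd (P, 0) h.mem_intIdeal a.1 (by ring)
  obtain ⟨c₂, rfl⟩ := hred c₂'
  have hdet : ∀ b ∈ D.intIdeal, ∃ u, red c₂ * red b.1 - red a.2 * red b.2 = red P * u := by
    intro b hb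
    obtain ⟨e, he⟩ := h.dvd_norm ha hb
    obtain ⟨u, hu⟩ := hdvd b hb e he
    refine ⟨u, mul_left_cancel₀ hf0 ?_⟩
    have := congrArg red he
    simp only [map_sub, map_mul] at this
    linear_combination this - red b.1 * hc₂' + red P * hu
  -- by Cramer's rule `a / y` lies in the ideal modulo `p`
  obtain ⟨a₁, ha₁, b₁, hb₁, d, hd, hdu, hgen⟩ := h.exists_generators p
  obtain ⟨u, hu⟩ := hdet a₁ ha₁
  obtain ⟨v, hv⟩ := hdet b₁ hb₁
  obtain ⟨d', hd'⟩ := hdu.exists_left_inv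
  change d' * red d = 1 at hd'
  obtain ⟨s, hs⟩ := hred (-d' * v)
  obtain ⟨t, ht⟩ := hred (d' * u)
  have hd := congrArg red hd
  simp only [map_sub, map_mul] at hd
  have hc : s • a₁ + t • b₁ ∈ D.intIdeal :=
    Submodule.add_mem _ (Submodule.smul_mem _ _ ha₁) (Submodule.smul_mem _ _ hb₁)
  have h1 : red (s • a₁ + t • b₁).1 = red a.2 := by
    simp only [Prod.fst_add, Prod.smul_fst, smul_eq_mul, map_add, map_mul, hs, ht]
    apply mul_left_cancel₀ hP0
    linear_combination d' * red a₁.1 * hv - d' * red b₁.1 * hu + d' * red a.2 * hd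
      + red P * red a.2 * hd'
  have h2 : red (s • a₁ + t • b₁).2 = red c₂ := by
    simp only [Prod.snd_add, Prod.smul_snd, smul_eq_mul, map_add, map_mul, hs, ht]
    apply mul_left_cancel₀ hP0
    linear_combination d' * red a₁.2 * hv - d' * red b₁.2 * hu + d' * red c₂ * hd
      + red P * red c₂ * hd'
  refine ⟨_, hc, ?_⟩
  obtain ⟨a', ha', e⟩ := exists_eq_smul_of_map_zmod_eq_zero p
    (a := a - ((s • a₁ + t • b₁).2 * f, (s • a₁ + t • b₁).1))
    (Submodule.sub_mem _ ha (D.y_mem_intIdeal hc))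
    (by
      change red _ = 0
      rw [Prod.fst_sub, map_sub, map_mul, h2, hc₂']
      ring)
    (by
      change red _ = 0
      rw [Prod.snd_sub, map_sub, h1, sub_self])
  exact ⟨a', ha', by rw [← e]; abel⟩

end IsLeastMultiple

end MumfordTriple

/-! ### The lattice -/

namespace MumfordTriple

open CurveRing

variable {g : ℕ} {f : ℤ[X]} (D : MumfordTriple g (f.map (Int.castRingHom ℚ)))

/-- The class in `W_D` of an integral section of `𝒪(-D)`. -/
noncomputable def intClass : D.intIdeal →ₗ[ℤ] D.W :=
  AddMonoidHom.toIntLinearMap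
    { toFun := fun a => D.classElt _ _ (D.mem_intIdeal.1 a.2)
      map_zero' := by
        have := D.classElt_mul 0 (D.mem_intIdeal.1 (0 : D.intIdeal).2)
        rw [map_zero, zero_smul] at this
        rw [← this]
        exact D.classElt_congr _ (by simp) (by simp)
      map_add' := fun a b => by
        rw [← D.classElt_add]
        exact D.classElt_congr _ (by simp) (by simp) }

theorem intClass_apply (a : D.intIdeal) :
    D.intClass a = D.classElt _ _ (D.mem_intIdeal.1 a.2) := rfl

theorem intClass_smul (r : ℤ[X]) (a : D.intIdeal) :
    D.intClass (r • a)
      = ofPoly (f.map (Int.castRingHom ℚ)) (r.map (Int.castRingHom ℚ)) • D.intClass a := by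
  rw [intClass_apply, intClass_apply, ← D.classElt_mul]
  exact D.classElt_congr _ (by simp) (by simp)

theorem intClass_y (a : D.intIdeal) : D.intClass ⟨_, D.y_mem_intIdeal a.2⟩ = 0 := by
  rw [intClass_apply, ← D.classElt_y (D.mem_intIdeal.1 a.2)]
  exact D.classElt_congr _ (by simp) rfl

/-- The lattice of all classes of integral sections of `𝒪(-D)`, scaled by the factor `c`. -/
noncomputable def lattice (c : ℚ) : Submodule ℤ D.W := LinearMap.range (c • D.intClass)

theorem ofPoly_smul_mem_lattice {c : ℚ} {v : D.W} (hv : v ∈ D.lattice c) (r : ℤ[X]) :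
    ofPoly (f.map (Int.castRingHom ℚ)) (r.map (Int.castRingHom ℚ)) • v ∈ D.lattice c := by
  obtain ⟨a, rfl⟩ := hv
  refine ⟨r • a, ?_⟩
  rw [LinearMap.smul_apply, LinearMap.smul_apply, intClass_smul, smul_comm]

theorem T_mem_lattice {c : ℚ} {v : D.W} (hv : v ∈ D.lattice c) : D.T v ∈ D.lattice c := by
  have := D.ofPoly_smul_mem_lattice hv X
  rwa [Polynomial.map_X] at this

/-- The integral ideal is a noetherian `ℤ[x]`-module whose classes are killed by `f`. -/
theorem fg_lattice (hf : f.Monic) (c : ℚ) : (D.lattice c).FG := by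
  have hdeg : f.natDegree = 2 * g + 1 := by
    rw [← D.natDegree_f, hf.natDegree_map]
  suffices h : (LinearMap.range D.intClass).FG by
    rw [lattice, LinearMap.range_eq_map, show (c • D.intClass : D.intIdeal →ₗ[ℤ] D.W)
      = ((LinearMap.lsmul ℚ D.W c).restrictScalars ℤ).comp D.intClass from rfl,
      Submodule.map_comp, ← LinearMap.range_eq_map]
    exact h.map _
  obtain ⟨s, hs⟩ := (inferInstance : Module.Finite ℤ[X] D.intIdeal).fg_top
  let S : Set D.W := (fun x : ℕ × D.intIdeal => D.intClass ((X ^ x.1 : ℤ[X]) • x.2)) ''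
    ((Finset.range (2 * g + 1) ×ˢ s : Finset _) : Set (ℕ × D.intIdeal))
  have hS : S.Finite := (Finset.finite_toSet _).image _
  have key : ∀ z : D.intIdeal, ∀ q : ℤ[X], D.intClass (q • z) ∈ Submodule.span ℤ S := by
    intro z
    have hz : z ∈ Submodule.span ℤ[X] (s : Set D.intIdeal) := hs ▸ Submodule.mem_top
    induction hz using Submodule.span_induction with
    | mem a ha =>
      intro q
      have h1 : D.intClass (q • a) = D.intClass ((q %ₘ f) • a) := by
        conv_lhs => rw [← modByMonic_add_div q f]
        rw [add_smul, map_add, mul_smul, D.intClass_smul f, D.f_smul, add_zero]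
      have hlt : (q %ₘ f).natDegree < 2 * g + 1 := by
        rw [← hdeg]
        exact natDegree_modByMonic_lt q hf (by rintro rfl; simp at hdeg)
      rw [h1, as_sum_range' _ _ hlt, Finset.sum_smul, map_sum]
      refine Submodule.sum_mem _ fun i hi => ?_
      have h2 : monomial i ((q %ₘ f).coeff i) • a
          = (q %ₘ f).coeff i • ((X ^ i : ℤ[X]) • a) := by
        rw [← smul_assoc, smul_eq_C_mul, C_mul_X_pow_eq_monomial]
      rw [h2, map_smul]
      refine Submodule.smul_mem _ _ (Submodule.subset_span ⟨(i, a), ?_, rfl⟩)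
      simpa [Nat.lt_succ_iff] using ⟨Nat.lt_succ_iff.1 (Finset.mem_range.1 hi), ha⟩
    | zero => intro q; simp
    | add a b _ _ iha ihb =>
      intro q
      rw [smul_add, map_add]
      exact Submodule.add_mem _ (iha q) (ihb q)
    | smul r a _ iha =>
      intro q
      rw [smul_smul]
      exact iha _
  have : LinearMap.range D.intClass = Submodule.span ℤ S := by
    apply le_antisymm
    · rintro _ ⟨z, rfl⟩
      have := key z 1
      rwa [one_smul] at this
    · rw [Submodule.span_le]
      rintro _ ⟨x, -, rfl⟩
      exact ⟨_, rfl⟩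
  rw [this]
  exact Submodule.fg_span hS

theorem span_lattice {c : ℚ} (hc : c ≠ 0) :
    Submodule.span ℚ (D.lattice c : Set D.W) = ⊤ := by
  rw [eq_top_iff]
  rintro v -
  obtain ⟨p, q, h, rfl⟩ := D.exists_eq_classElt v
  obtain ⟨k, P, hk, hP⟩ := exists_map_eq_C_mul p
  obtain ⟨l, Q, hl, hQ⟩ := exists_map_eq_C_mul q
  have e₁ : (C l * P).map (Int.castRingHom ℚ) = C ((k * l : ℤ) : ℚ) * p := by
    rw [Polynomial.map_mul, hP, map_C, eq_intCast, Int.cast_mul, C_mul]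
    ring
  have e₂ : (C k * Q).map (Int.castRingHom ℚ) = C ((k * l : ℤ) : ℚ) * q := by
    rw [Polynomial.map_mul, hQ, map_C, eq_intCast, Int.cast_mul, C_mul]
    ring
  have hmem : (C l * P, C k * Q) ∈ D.intIdeal := by
    rw [mem_intIdeal, e₁, e₂]
    exact D.dvd_mul_pair _ h
  have h1 : D.intClass ⟨_, hmem⟩ = ((k * l : ℤ) : ℚ) • D.classElt p q h := by
    rw [intClass_apply, ← ofPoly_C_smul, ← D.classElt_mul]
    exact D.classElt_congr _ e₁ e₂
  have hkl : ((k * l : ℤ) : ℚ) ≠ 0 := by exact_mod_cast mul_ne_zero hk hl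
  have h2 : D.classElt p q h = (((k * l : ℤ) : ℚ)⁻¹ * c⁻¹) • (c • D.intClass ⟨_, hmem⟩) := by
    rw [h1, smul_smul, smul_smul]
    field_simp
    rw [one_smul]
  rw [h2]
  exact Submodule.smul_mem _ _ (Submodule.subset_span ⟨_, rfl⟩)

variable {D} {M : ℕ} {P : ℤ[X]}

theorem IsLeastMultiple.form_intClass (h : D.IsLeastMultiple M P) (hf : f.Monic)
    {a b : D.intIdeal} {e : ℤ[X]}
    (he : (a : ℤ[X] × ℤ[X]).1 * (b : ℤ[X] × ℤ[X]).1
      - (a : ℤ[X] × ℤ[X]).2 * (b : ℤ[X] × ℤ[X]).2 * f = P * e) :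
    D.form (D.intClass a) (D.intClass b)
      = M * ((-1) ^ D.U.natDegree * (e %ₘ f).coeff (2 * g) : ℤ) := by
  have := congrArg (Polynomial.map (Int.castRingHom ℚ)) he
  simp only [Polynomial.map_sub, Polynomial.map_mul, h.map_eq] at this
  rw [intClass_apply, intClass_apply, D.form_classElt _ _
    (e := (M : ℚ) • e.map (Int.castRingHom ℚ)) (by rw [this, smul_eq_C_mul]; ring),
    smul_modByMonic, coeff_smul, ← map_modByMonic _ hf, coeff_map, eq_intCast]
  push_cast
  rw [smul_eq_mul]
  ring

/-- The lattice has a basis whose Gram matrix, for the form scaled so that it becomes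
`± τ(a ι(b) / P mod y)` on integral sections, is unimodular. -/
theorem IsLeastMultiple.exists_gram (h : D.IsLeastMultiple M P) (hf : f.Monic) {c : ℚ}
    (hc : c ≠ 0) :
    ∃ (n : ℕ) (b : Module.Basis (Fin n) ℚ D.W) (G : Matrix (Fin n) (Fin n) ℤ),
      D.lattice c = Submodule.span ℤ (Set.range b) ∧
      (∀ i j, ((c ^ 2 * M)⁻¹ • D.form) (b i) (b j) = G i j) ∧ IsUnit G.det := by
  have hdeg : f.natDegree = 2 * g + 1 := by
    rw [← D.natDegree_f, hf.natDegree_map]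
  obtain ⟨n, b, hb⟩ := exists_basis_of_fg_of_span_eq_top (D.fg_lattice hf c) (D.span_lattice hc)
  have hM : (M : ℚ) ≠ 0 := by simpa using h.pos.ne'
  have hform : ∀ (a b : D.intIdeal) (e : ℤ[X]), (a : ℤ[X] × ℤ[X]).1 * (b : ℤ[X] × ℤ[X]).1
      - (a : ℤ[X] × ℤ[X]).2 * (b : ℤ[X] × ℤ[X]).2 * f = P * e →
      ((c ^ 2 * M)⁻¹ • D.form) (c • D.intClass a) (c • D.intClass b)
        = ((-1) ^ D.U.natDegree * (e %ₘ f).coeff (2 * g) : ℤ) := by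
    intro a b e he
    rw [LinearMap.smul_apply, LinearMap.smul_apply, map_smul, map_smul, LinearMap.smul_apply,
      h.form_intClass hf he]
    simp only [smul_eq_mul]
    field_simp
  have hint : ∀ v ∈ D.lattice c, ∀ w ∈ D.lattice c,
      ∃ z : ℤ, ((c ^ 2 * M)⁻¹ • D.form) v w = z := by
    rintro _ ⟨a, rfl⟩ _ ⟨b, rfl⟩
    obtain ⟨e, he⟩ := h.dvd_norm a.2 b.2
    exact ⟨_, hform a b e he⟩
  have hbL : ∀ i, b i ∈ D.lattice c := fun i => hb ▸ Submodule.subset_span ⟨i, rfl⟩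
  choose G hG using fun i j => hint _ (hbL i) _ (hbL j)
  refine ⟨n, b, G, hb, hG, isUnit_det_gram b hb hG ?_⟩
  rintro p hp _ ⟨a, rfl⟩ ha
  have : Fact p.Prime := ⟨hp⟩
  obtain ⟨u, hu, a', ha', e⟩ := h.exists_of_forall_dvd_tau hf hdeg p a.2 (by
    intro b hb e he
    obtain ⟨z, hz⟩ := ha _ ⟨⟨b, hb⟩, rfl⟩
    replace hz := (hform a ⟨b, hb⟩ e he).symm.trans hz
    have hz' : (-1) ^ D.U.natDegree * (e %ₘ f).coeff (2 * g) = p * z := by exact_mod_cast hz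
    have hu : IsUnit ((-1 : ℤ) ^ D.U.natDegree) := (isUnit_one.neg).pow _
    exact hu.dvd_mul_left.1 ⟨z, hz'⟩)
  refine ⟨_, ⟨⟨a', ha'⟩, rfl⟩, ?_⟩
  have h1 : a = ⟨_, D.y_mem_intIdeal hu⟩ + (p : ℤ) • (⟨a', ha'⟩ : D.intIdeal) := by
    ext1
    refine e.trans (congrArg _ ?_)
    ext1 <;> simp
  rw [h1, map_add, map_smul, LinearMap.smul_apply c, D.intClass_y ⟨u, hu⟩, smul_zero, zero_add]

end MumfordTriple

/-! ### The standard basis of `W_D` and its Gram determinant -/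

theorem det_of_blockTriangular_injective {ι R : Type*} [Fintype ι] [DecidableEq ι] [CommRing R]
    {A : Matrix ι ι R} {w : ι → ℕ} (hw : Function.Injective w) (h : A.BlockTriangular w) :
    A.det = ∏ i, A i i := by
  rw [h.det, Finset.prod_image fun _ _ _ _ e => hw e]
  refine Finset.prod_congr rfl fun i _ => ?_
  have : Subsingleton {j // w j = w i} := ⟨fun x y => Subtype.ext (hw (x.2.trans y.2.symm))⟩
  rw [Matrix.det_eq_elem_of_subsingleton _ ⟨i, rfl⟩]
  rfl

theorem coeff_modByMonic_of_natDegree_lt {k : Type*} [Field k] {f h : k[X]} (hf : f.Monic)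
    (hh : h.natDegree < f.natDegree) (n : ℕ) : (h %ₘ f).coeff n = h.coeff n := by
  rw [(modByMonic_eq_self_iff hf).2 (degree_lt_degree hh)]

namespace MumfordTriple

open CurveRing

variable {k : Type*} [Field k] {g : ℕ} {f : k[X]} (D : MumfordTriple g f)

/-- The class of `y - R` in `W_D`. -/
noncomputable def classYSubR : D.W := D.classElt (-D.R) 1 (by simp)

/-- The family `U, x U, …, x ^ (2g - m) U, y - R, x (y - R), …, x ^ (m - 1) (y - R)` in `W_D`,
where `m = deg U`. -/
noncomputable def stdFamily : Fin (2 * g + 1 - D.U.natDegree) ⊕ Fin D.U.natDegree → D.W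
  | .inl i => D.classElt (X ^ (i : ℕ) * D.U) (X ^ (i : ℕ) * 0) (D.dvd_mul_pair _ (by simp))
  | .inr j => D.classElt (X ^ (j : ℕ) * -D.R) (X ^ (j : ℕ) * 1) (D.dvd_mul_pair _ (by simp))

theorem stdFamily_inl (i) :
    D.stdFamily (.inl i) = ofPoly f (X ^ (i : ℕ)) • D.classU := by
  rw [stdFamily, classElt_mul, classU_eq]

theorem stdFamily_inr (j) :
    D.stdFamily (.inr j) = ofPoly f (X ^ (j : ℕ)) • D.classYSubR := by
  rw [stdFamily, classElt_mul, classYSubR]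

/-- This and `U_smul_classYSubR` are the relations `y (y - R) = 0` and `y U = 0` in `W_D`. -/
theorem V_smul_classU : ofPoly f D.V • D.classU = ofPoly f D.R • D.classYSubR := by
  have h := D.classElt_y (p := -D.R) (q := 1) (by simp)
  have e : ofPoly f D.V • D.classU + ofPoly f (-D.R) • D.classYSubR = 0 := by
    rw [classU_eq, classYSubR, ← classElt_mul, ← classElt_mul, ← classElt_add, ← h]
    exact D.classElt_congr _ (by linear_combination D.mul_eq) (by ring)
  rw [map_neg, neg_smul] at e
  exact add_neg_eq_zero.1 e

theorem U_smul_classYSubR : ofPoly f D.U • D.classYSubR = -(ofPoly f D.R • D.classU) := by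
  have h := D.classElt_y (p := D.U) (q := 0) (by simp)
  have e : ofPoly f D.U • D.classYSubR + ofPoly f D.R • D.classU = 0 := by
    rw [classU_eq, classYSubR, ← classElt_mul, ← classElt_mul, ← classElt_add, ← h]
    exact D.classElt_congr _ (by ring) (by ring)
  exact eq_neg_of_add_eq_zero_left e

theorem ofPoly_smul_mem_of_degree_lt {S : Submodule k D.W} {v : D.W} {n : ℕ}
    (h : ∀ i < n, ofPoly f (X ^ i) • v ∈ S) {r : k[X]} (hr : r.degree < n) :
    ofPoly f r • v ∈ S := by
  rw [as_sum_range_C_mul_X_pow r, map_sum, Finset.sum_smul]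
  refine Submodule.sum_mem _ fun i hi => ?_
  rw [map_mul, mul_smul, ofPoly_C_smul]
  by_cases hr0 : r = 0
  · simp [hr0]
  · refine Submodule.smul_mem _ _ (h i ?_)
    rw [degree_eq_natDegree hr0, Nat.cast_lt] at hr
    have := Finset.mem_range.1 hi
    omega

theorem span_stdFamily : Submodule.span k (Set.range D.stdFamily) = ⊤ := by
  set S := Submodule.span k (Set.range D.stdFamily) with hS
  have hmg := D.natDegree_U_le
  have h₁ : ∀ i < 2 * g + 1 - D.U.natDegree, ofPoly f (X ^ i) • D.classU ∈ S := fun i hi => by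
    rw [← D.stdFamily_inl ⟨i, hi⟩]
    exact Submodule.subset_span ⟨_, rfl⟩
  have h₂ : ∀ j < D.U.natDegree, ofPoly f (X ^ j) • D.classYSubR ∈ S := fun j hj => by
    rw [← D.stdFamily_inr ⟨j, hj⟩]
    exact Submodule.subset_span ⟨_, rfl⟩
  have hR : D.R.degree < ((2 * g + 1 - D.U.natDegree : ℕ) : WithBot ℕ) :=
    D.degree_R_lt.trans_le (by rw [Nat.cast_le]; omega)
  have hsub : ∀ {q : k[X]}, q.Monic → (X ^ q.natDegree - q).degree < (q.natDegree : WithBot ℕ) := by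
    intro q hq
    have hd : (X ^ q.natDegree : k[X]).degree = q.degree := by
      rw [degree_X_pow, degree_eq_natDegree hq.ne_zero]
    have := degree_sub_lt_left hd (pow_ne_zero _ X_ne_zero)
      (by rw [leadingCoeff_X_pow, hq.leadingCoeff])
    rwa [degree_X_pow] at this
  -- reduction of the first power of `x` beyond each half of the family
  have h₁' : ofPoly f (X ^ (2 * g + 1 - D.U.natDegree)) • D.classU ∈ S := by
    have e : (X ^ (2 * g + 1 - D.U.natDegree) : k[X]) = (X ^ D.V.natDegree - D.V) + D.V := by
      rw [D.natDegree_V]; ring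
    rw [e, map_add, add_smul, V_smul_classU]
    refine Submodule.add_mem _ (D.ofPoly_smul_mem_of_degree_lt h₁ ?_)
      (D.ofPoly_smul_mem_of_degree_lt h₂ D.degree_R_lt)
    rw [← D.natDegree_V]
    exact hsub D.monic_V
  have h₂' : ofPoly f (X ^ D.U.natDegree) • D.classYSubR ∈ S := by
    have e : (X ^ D.U.natDegree : k[X]) = (X ^ D.U.natDegree - D.U) + D.U := by ring
    rw [e, map_add, add_smul, U_smul_classYSubR]
    exact Submodule.add_mem _ (D.ofPoly_smul_mem_of_degree_lt h₂ (hsub D.monic_U))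
      (Submodule.neg_mem _ (D.ofPoly_smul_mem_of_degree_lt h₁ hR))
  have hT : S ≤ S.comap D.T := by
    conv_lhs => rw [hS]
    rw [Submodule.span_le]
    rintro _ ⟨i | j, rfl⟩
    · rw [SetLike.mem_coe, Submodule.mem_comap, stdFamily_inl, T_apply, smul_smul, ← map_mul,
        ← pow_succ']
      rcases (Nat.succ_le_of_lt i.2).lt_or_eq with hi | hi
      · exact h₁ _ hi
      · rw [← hi] at h₁'
        exact h₁'
    · rw [SetLike.mem_coe, Submodule.mem_comap, stdFamily_inr, T_apply, smul_smul, ← map_mul,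
        ← pow_succ']
      rcases (Nat.succ_le_of_lt j.2).lt_or_eq with hj | hj
      · exact h₂ _ hj
      · rw [← hj] at h₂'
        exact h₂'
  have hpoly : ∀ (r : k[X]) (v : D.W), v ∈ S → ofPoly f r • v ∈ S := by
    intro r v hv
    have hpow : ∀ n : ℕ, ofPoly f (X ^ n) • v ∈ S := fun n => by
      induction n with
      | zero => simpa using hv
      | succ n ih =>
        have := hT ih
        rwa [Submodule.mem_comap, T_apply, smul_smul, ← map_mul, ← pow_succ'] at this
    exact D.ofPoly_smul_mem_of_degree_lt (n := r.natDegree + 1) (fun i _ => hpow i)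
      (degree_le_natDegree.trans_lt (by exact_mod_cast Nat.lt_succ_self _))
  have hu : D.classU ∈ S := by
    have := h₁ 0 (by omega)
    simpa using this
  have hw : D.classYSubR ∈ S := by
    rcases Nat.eq_zero_or_pos D.U.natDegree with h0 | h0
    · rw [h0] at h₂'
      simpa using h₂'
    · simpa using h₂ 0 h0
  rw [eq_top_iff]
  rintro v -
  obtain ⟨p, q, h, rfl⟩ := D.exists_eq_classElt v
  obtain ⟨s, hs⟩ := h
  have e : D.classElt p q ⟨s, hs⟩ = ofPoly f s • D.classU + ofPoly f q • D.classYSubR := by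
    rw [classU_eq, classYSubR, ← classElt_mul, ← classElt_mul, ← classElt_add]
    exact D.classElt_congr _ (by linear_combination hs) (by ring)
  rw [e]
  exact Submodule.add_mem _ (hpoly _ _ hu) (hpoly _ _ hw)

/-- The order of the pole at infinity minus `deg U`, for the sections of the standard family; two
of them are orthogonal if their weights add up to less than `4 g`. -/
def stdWeight : Fin (2 * g + 1 - D.U.natDegree) ⊕ Fin D.U.natDegree → ℕ
  | .inl i => 2 * i + D.U.natDegree
  | .inr j => 2 * j + (2 * g + 1 - D.U.natDegree)

/-- The involution of the index set of the standard family that sends weight `w` to `4 g - w`. -/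
def stdRev : Equiv.Perm (Fin (2 * g + 1 - D.U.natDegree) ⊕ Fin D.U.natDegree) :=
  Equiv.sumCongr Fin.revPerm Fin.revPerm

theorem stdWeight_injective : Function.Injective D.stdWeight := by
  have := D.natDegree_U_le
  rintro (i | i) (j | j) h <;> simp only [stdWeight] at h
  · congr 1; ext; omega
  · omega
  · omega
  · congr 1; ext; omega

theorem stdWeight_stdRev (i) : D.stdWeight (D.stdRev i) + D.stdWeight i = 4 * g := by
  have := D.natDegree_U_le
  rcases i with i | j
  · have := i.2
    simp only [stdRev, Equiv.sumCongr_apply, Sum.map_inl, Fin.revPerm_apply, stdWeight, Fin.val_rev]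
    omega
  · have := j.2
    simp only [stdRev, Equiv.sumCongr_apply, Sum.map_inr, Fin.revPerm_apply, stdWeight, Fin.val_rev]
    omega

/-- The polynomial of which `τ` gives, up to the sign `(-1) ^ deg U`, the Gram matrix of the
standard family. -/
noncomputable def stdPairing :
    Fin (2 * g + 1 - D.U.natDegree) ⊕ Fin D.U.natDegree →
      Fin (2 * g + 1 - D.U.natDegree) ⊕ Fin D.U.natDegree → k[X]
  | .inl i, .inl j => X ^ (i + j : ℕ) * D.U
  | .inl i, .inr j => X ^ (i + j : ℕ) * -D.R
  | .inr i, .inl j => X ^ (i + j : ℕ) * -D.R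
  | .inr i, .inr j => X ^ (i + j : ℕ) * -D.V

theorem form_stdFamily (a b) : D.form (D.stdFamily a) (D.stdFamily b)
    = (-1) ^ D.U.natDegree * (D.stdPairing a b %ₘ f).coeff (2 * g) := by
  rcases a with i | i <;> rcases b with j | j <;> simp only [stdFamily] <;>
    refine D.form_classElt _ _ ?_ <;> simp only [stdPairing]
  · ring
  · ring
  · ring
  · linear_combination (X ^ (i + j : ℕ)) * D.mul_eq

theorem natDegree_stdPairing_lt {a b} (h : D.stdWeight a + D.stdWeight b < 4 * g) :
    (D.stdPairing a b).natDegree < 2 * g := by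
  have hmg := D.natDegree_U_le
  have hV := D.natDegree_V
  have hR : D.R = 0 ∨ D.R.natDegree < D.U.natDegree := by
    by_cases hR : D.R = 0
    · exact .inl hR
    · right
      have h1 := D.degree_R_lt
      rwa [degree_eq_natDegree hR, Nat.cast_lt] at h1
  have key : ∀ (n : ℕ) (q : k[X]), n + q.natDegree < 2 * g → (X ^ n * q).natDegree < 2 * g :=
    fun n q hq => natDegree_mul_le.trans_lt (by rwa [natDegree_X_pow])
  rcases a with i | i <;> rcases b with j | j <;> simp only [stdWeight] at h <;>
    simp only [stdPairing]
  · exact key _ _ (by omega)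
  · rcases hR with hR | hR
    · simp [hR]; omega
    · exact key _ _ (by rw [natDegree_neg]; omega)
  · rcases hR with hR | hR
    · simp [hR]; omega
    · exact key _ _ (by rw [natDegree_neg]; omega)
  · exact key _ _ (by rw [natDegree_neg]; omega)

theorem stdPairing_stdRev (a) : (D.stdPairing a (D.stdRev a)).natDegree = 2 * g ∧
    (D.stdPairing a (D.stdRev a)).coeff (2 * g) ^ 2 = 1 := by
  have hmg := D.natDegree_U_le
  have hV := D.natDegree_V
  have key : ∀ (n : ℕ) (q : k[X]), q.Monic → n + q.natDegree = 2 * g →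
      (X ^ n * q).natDegree = 2 * g ∧ (X ^ n * q).coeff (2 * g) = 1 := fun n q hq hn => by
    have hd : (X ^ n * q).natDegree = 2 * g := by
      rw [(monic_X_pow n).natDegree_mul hq, natDegree_X_pow, hn]
    refine ⟨hd, ?_⟩
    rw [← hd]
    exact (monic_X_pow n).mul hq
  rcases a with i | i
  · have := i.2
    obtain ⟨h1, h2⟩ := key (i + Fin.rev i : ℕ) D.U D.monic_U (by rw [Fin.val_rev]; omega)
    exact ⟨h1, by
      change (X ^ (i + Fin.rev i : ℕ) * D.U).coeff (2 * g) ^ 2 = 1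
      rw [h2, one_pow]⟩
  · have := i.2
    obtain ⟨h1, h2⟩ := key (i + Fin.rev i : ℕ) D.V D.monic_V (by rw [Fin.val_rev]; omega)
    change (X ^ (i + Fin.rev i : ℕ) * -D.V).natDegree = _ ∧
      (X ^ (i + Fin.rev i : ℕ) * -D.V).coeff (2 * g) ^ 2 = 1
    rw [mul_neg, natDegree_neg, coeff_neg, h2]
    exact ⟨h1, by ring⟩

/-- The Gram matrix of the standard family is triangular with entries `±1` on the diagonal, once
its columns are permuted and its rows and columns are ordered by weight. -/
theorem det_gram_stdFamily_sq :
    (Matrix.of fun i j => D.form (D.stdFamily i) (D.stdFamily j)).det ^ 2 = 1 := by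
  set G := Matrix.of fun i j => D.form (D.stdFamily i) (D.stdFamily j)
  have hG : ∀ i j, G i j = D.form (D.stdFamily i) (D.stdFamily j) := fun _ _ => rfl
  have hf := D.natDegree_f
  have hsign : ((-1 : k) ^ D.U.natDegree) ^ 2 = 1 := by
    rw [← pow_mul, mul_comm, pow_mul]; simp
  have htri : (G.submatrix id D.stdRev).transpose.BlockTriangular D.stdWeight := by
    intro i j hij
    have h := D.stdWeight_stdRev i
    have hdeg := D.natDegree_stdPairing_lt (a := j) (b := D.stdRev i) (by omega)
    rw [Matrix.transpose_apply, Matrix.submatrix_apply, hG, id, form_stdFamily,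
      coeff_modByMonic_of_natDegree_lt D.monic_f (by omega), coeff_eq_zero_of_natDegree_lt hdeg,
      mul_zero]
  have h1 := det_of_blockTriangular_injective D.stdWeight_injective htri
  rw [Matrix.det_transpose, Matrix.det_permute'] at h1
  have h2 := congrArg (· ^ 2) h1
  simp only [mul_pow, ← Finset.prod_pow] at h2
  have hs : (((Equiv.Perm.sign D.stdRev : ℤˣ) : ℤ) : k) ^ 2 = 1 := by
    rcases Int.units_eq_one_or (Equiv.Perm.sign D.stdRev) with h | h <;> simp [h]
  rw [hs, one_mul] at h2
  rw [h2]
  refine Finset.prod_eq_one fun a _ => ?_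
  obtain ⟨h3, h4⟩ := D.stdPairing_stdRev a
  rw [Matrix.transpose_apply, Matrix.submatrix_apply, hG, id, form_stdFamily,
      coeff_modByMonic_of_natDegree_lt D.monic_f (by omega), mul_pow, hsign, h4, one_mul]

theorem linearIndependent_stdFamily : LinearIndependent k D.stdFamily := by
  rw [Fintype.linearIndependent_iff]
  intro c hc
  have hdet : (Matrix.of fun i j => D.form (D.stdFamily i) (D.stdFamily j)).det ≠ 0 := by
    intro h
    simpa [h] using D.det_gram_stdFamily_sq
  have := Matrix.eq_zero_of_vecMul_eq_zero hdet (v := c) (by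
    ext j
    simp only [Matrix.vecMul, dotProduct, Matrix.of_apply, Pi.zero_apply]
    rw [← LinearMap.map_zero₂ D.form (D.stdFamily j), ← hc]
    simp)
  exact congrFun this

/-- The standard basis of `W_D`. -/
noncomputable def stdBasis :
    Module.Basis (Fin (2 * g + 1 - D.U.natDegree) ⊕ Fin D.U.natDegree) k D.W :=
  Module.Basis.mk D.linearIndependent_stdFamily D.span_stdFamily.ge

theorem stdBasis_apply (i) : D.stdBasis i = D.stdFamily i := Module.Basis.mk_apply _ _ i

theorem det_toMatrix_stdBasis_sq :
    (LinearMap.BilinForm.toMatrix D.stdBasis D.form).det ^ 2 = 1 := by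
  rw [← D.det_gram_stdFamily_sq]
  congr 2
  ext i j
  rw [LinearMap.BilinForm.toMatrix_apply, Matrix.of_apply, stdBasis_apply, stdBasis_apply]

end MumfordTriple

/-! ### The leading coefficient is a square, and primitivity -/

namespace MumfordTriple

open CurveRing

variable {g : ℕ} {f : ℤ[X]} {D : MumfordTriple g (f.map (Int.castRingHom ℚ))} {M : ℕ} {P : ℤ[X]}

namespace IsLeastMultiple

/-- The lattice of classes of integral sections is unimodular for the form scaled by `1 / M`, so
`M ^ (2g + 1)` is, up to sign and squares, the discriminant `±1` of `W_D`. -/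
theorem exists_eq_sq (h : D.IsLeastMultiple M P) (hf : f.Monic) : ∃ N : ℕ, M = N ^ 2 := by
  obtain ⟨n, b, G, -, hG, hdet⟩ := h.exists_gram hf one_ne_zero
  have hM : (M : ℚ) ≠ 0 := by simpa using h.pos.ne'
  have hmg := D.natDegree_U_le
  let e := b.indexEquiv D.stdBasis
  have hn : n = 2 * g + 1 := by
    have := Fintype.card_congr e
    simp only [Fintype.card_fin, Fintype.card_sum] at this
    omega
  set A := LinearMap.BilinForm.toMatrix (b.reindex e) D.form with hA
  have hAdet : A.det ^ 2 = ((M : ℚ) ^ (2 * g + 1)) ^ 2 := by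
    have h1 : A = ((M : ℚ) • G.map (Int.castRingHom ℚ)).submatrix e.symm e.symm := by
      ext i j
      have := hG (e.symm i) (e.symm j)
      rw [LinearMap.smul_apply, LinearMap.smul_apply, one_pow, one_mul, smul_eq_mul,
        inv_mul_eq_iff_eq_mul₀ hM] at this
      rw [hA, LinearMap.BilinForm.toMatrix_apply, Module.Basis.reindex_apply,
        Module.Basis.reindex_apply, this]
      rfl
    have h2 : (G.map (Int.castRingHom ℚ)).det ^ 2 = 1 := by
      have h3 : (G.map (Int.castRingHom ℚ)).det = Int.castRingHom ℚ G.det := by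
        rw [RingHom.map_det]; rfl
      rw [h3, ← map_pow, sq, Int.isUnit_mul_self hdet, map_one]
    rw [h1, Matrix.det_submatrix_equiv_self, Matrix.det_smul, Fintype.card_fin, mul_pow, h2,
      mul_one, hn]
  have hchange := congrArg Matrix.det
    (LinearMap.BilinForm.toMatrix_mul_basis_toMatrix D.stdBasis (b.reindex e) D.form)
  rw [Matrix.det_mul, Matrix.det_mul, Matrix.det_transpose, ← hA] at hchange
  set q := (D.stdBasis.toMatrix (b.reindex e)).det
  have hq : (q ^ 2) ^ 2 = ((M : ℚ) ^ (2 * g + 1)) ^ 2 := by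
    rw [← hAdet, ← hchange]
    linear_combination -(q ^ 2) ^ 2 * D.det_toMatrix_stdBasis_sq
  have hq' : q ^ 2 = (M : ℚ) ^ (2 * g + 1) :=
    (pow_left_inj₀ (sq_nonneg q) (by positivity) two_ne_zero).1 hq
  -- the exponent `2 g + 1` is odd
  have hsq : IsSquare (M : ℚ) := ⟨q / (M : ℚ) ^ g, by
    field_simp
    rw [hq']
    ring⟩
  rw [Rat.isSquare_natCast_iff] at hsq
  obtain ⟨N, hN⟩ := hsq
  exact ⟨N, by rw [hN, sq]⟩

theorem isUnimodularZLattice (h : D.IsLeastMultiple M P) (hf : f.Monic) {N : ℕ} (hN : M = N ^ 2) :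
    IsUnimodularZLattice D.form (D.lattice (N : ℚ)⁻¹) := by
  have hN0 := h.sqrt_ne_zero hN
  obtain ⟨n, b, G, hb, hG, hdet⟩ := h.exists_gram hf (inv_ne_zero hN0)
  have h1 : ((N : ℚ)⁻¹ ^ 2 * M)⁻¹ = 1 := by
    rw [hN]
    push_cast
    field_simp
  rw [h1, one_smul] at hG
  exact isUnimodularZLattice_of_isUnit_det b hb hG hdet

theorem smul_classU_mem_lattice (h : D.IsLeastMultiple M P) {N : ℕ} (hN : M = N ^ 2) :
    N • D.classU ∈ D.lattice (N : ℚ)⁻¹ := by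
  have hN0 := h.sqrt_ne_zero hN
  refine ⟨⟨_, h.mem_intIdeal⟩, ?_⟩
  have h1 : D.intClass ⟨_, h.mem_intIdeal⟩ = (M : ℚ) • D.classU := by
    rw [intClass_apply, classU_eq, ← ofPoly_C_smul, ← classElt_mul]
    exact D.classElt_congr _ h.map_eq (by simp)
  rw [LinearMap.smul_apply, h1, smul_smul, ← Nat.cast_smul_eq_nsmul ℚ, hN]
  congr 1
  push_cast
  field_simp

theorem form_smul_classU (h : D.IsLeastMultiple M P) (hf : f.Monic) {N : ℕ} (hN : M = N ^ 2)
    (r : ℤ[X]) :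
    D.form (N • D.classU)
      (ofPoly (f.map (Int.castRingHom ℚ)) (r.map (Int.castRingHom ℚ)) • (N • D.classU))
      = ((-1) ^ D.U.natDegree * ((r * P) %ₘ f).coeff (2 * g) : ℤ) := by
  rw [← Nat.cast_smul_eq_nsmul ℚ, smul_comm, LinearMap.BilinForm.smul_right,
    LinearMap.BilinForm.smul_left, classU_eq,
    ← classElt_mul, D.form_classElt _ _ (e := r.map (Int.castRingHom ℚ) * D.U) (by ring)]
  have h1 : (((r * P) %ₘ f).coeff (2 * g) : ℚ)
      = M * ((r.map (Int.castRingHom ℚ) * D.U) %ₘ f.map (Int.castRingHom ℚ)).coeff (2 * g) := by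
    rw [← eq_intCast (Int.castRingHom ℚ), ← coeff_map, map_modByMonic _ hf, Polynomial.map_mul,
      h.map_eq, mul_left_comm, ← smul_eq_C_mul, smul_modByMonic, coeff_smul, smul_eq_mul]
  push_cast
  rw [h1, hN]
  push_cast
  ring

/-- The values `(v, x ^ j v)` for `v = N U` are up to sign the coefficients of the primitive
polynomial `P`, each modified by multiples of the higher ones. -/
theorem isPrimitiveVector (h : D.IsLeastMultiple M P) (hf : f.Monic) {N : ℕ} (hN : M = N ^ 2) :
    IsPrimitiveVector (D.lattice (N : ℚ)⁻¹) (N • D.classU) := by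
  refine ⟨h.smul_classU_mem_lattice hN, fun n w hw e => ?_⟩
  obtain ⟨-, u, hu⟩ := h.isUnimodularZLattice hf hN
  have hdeg : f.natDegree = 2 * g + 1 := by
    rw [← D.natDegree_f, hf.natDegree_map]
  have hval : ∀ i : ℕ, n ∣ ((X ^ i * P) %ₘ f).coeff (2 * g) := by
    intro i
    have h1 := h.form_smul_classU hf hN (X ^ i)
    have hmem := D.ofPoly_smul_mem_lattice (h.smul_classU_mem_lattice hN) (X ^ i)
    nth_rewrite 1 [e] at h1
    rw [map_zsmul, LinearMap.smul_apply, ← hu ⟨w, hw⟩ ⟨_, hmem⟩, zsmul_eq_mul] at h1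
    have hu : IsUnit ((-1 : ℤ) ^ D.U.natDegree) := (isUnit_one.neg).pow _
    refine hu.dvd_mul_left.1 ⟨u ⟨w, hw⟩ ⟨_, hmem⟩, ?_⟩
    exact_mod_cast h1.symm
  have hPdeg : P.natDegree < f.natDegree := by
    have h1 := congrArg natDegree h.map_eq
    rw [natDegree_map_eq_of_injective (RingHom.injective_int _),
      natDegree_C_mul (by simpa using h.pos.ne')] at h1
    have := D.natDegree_U_le
    omega
  have hf1 : f ≠ 1 := by rintro rfl; simp at hdeg
  refine h.isPrimitive n ?_
  -- otherwise the leading coefficient of `P` modulo `n` would be one of these values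
  have key : P.map (Ideal.Quotient.mk (Ideal.span {n})) = 0 := by
    by_contra hP0
    set φ := Ideal.Quotient.mk (Ideal.span {n})
    have hd : (P.map φ).natDegree ≤ 2 * g := natDegree_map_le.trans (by omega)
    have h1 := (Ideal.Quotient.eq_zero_iff_dvd n _).2 (hval (2 * g - (P.map φ).natDegree))
    have hnt : Nontrivial (ℤ ⧸ Ideal.span {n}) := by
      by_contra hnt
      rw [not_nontrivial_iff_subsingleton] at hnt
      exact hP0 (Subsingleton.elim _ _)
    rw [← coeff_map, map_modByMonic _ hf, Polynomial.map_mul, Polynomial.map_pow, map_X,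
      (modByMonic_eq_self_iff (hf.map _)).2, coeff_X_pow_mul', if_pos (by omega),
      Nat.sub_sub_self hd, coeff_natDegree, leadingCoeff_eq_zero] at h1
    · exact hP0 h1
    · refine degree_lt_degree ?_
      rw [natDegree_X_pow_mul, hf.natDegree_map]
      · rw [Nat.add_sub_of_le hd, hdeg]
        exact Nat.lt_succ_self _
      · exact hP0
  rw [C_dvd_iff_dvd_coeff]
  intro i
  rw [← Ideal.Quotient.eq_zero_iff_dvd, ← coeff_map, key, coeff_zero]

end IsLeastMultiple

end MumfordTriple

/-! ### Inner products attached to a diagonalisable self-adjoint operator -/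

open ComplexConjugate

/-- A polynomial with real coefficients takes prescribed values at finitely many complex points,
as soon as these values are compatible with complex conjugation. -/
theorem exists_aeval_eq_of_conj {s : Finset ℂ} (hs : ∀ ω ∈ s, conj ω ∈ s) {c : ℂ → ℂ}
    (hc : ∀ ω ∈ s, c (conj ω) = conj (c ω)) : ∃ p : ℝ[X], ∀ ω ∈ s, aeval ω p = c ω := by
  classical
  let q : ℂ[X] := Lagrange.interpolate s id c
  have hq : ∀ ω ∈ s, q.eval ω = c ω := fun ω hω =>
    Lagrange.eval_interpolate_at_node c Function.injective_id.injOn hω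
  let p : ℝ[X] := ∑ i ∈ Finset.range (q.natDegree + 1), C (q.coeff i).re * X ^ i
  have hp : ∀ ω : ℂ, aeval ω p = (q.eval ω + conj (q.eval (conj ω))) / 2 := fun ω => by
    rw [eval_eq_sum_range, eval_eq_sum_range, map_sum, map_sum, ← Finset.sum_add_distrib,
      Finset.sum_div]
    refine Finset.sum_congr rfl fun i _ => ?_
    simp only [map_mul, aeval_C, map_pow, aeval_X, Complex.conj_conj, Complex.coe_algebraMap]
    rw [← add_mul, Complex.add_conj]
    push_cast
    ring
  refine ⟨p, fun ω hω => ?_⟩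
  rw [hp, hq ω hω, hq _ (hs ω hω), hc ω hω, Complex.conj_conj]
  ring

/-- A simultaneous diagonalisation over `ℂ` of the operator `T` and the symmetric form `B` on a
real vector space `W`: complex linear functionals `ev ω`, indexed by the finite set `s` of
eigenvalues, which turn `T` into multiplication by `ω` and `B` into `∑ κ ω x ω y ω`. All of it is
compatible with complex conjugation, the coefficients `κ ω` are nonzero, and no coordinate of `v₀`
vanishes, so that `v₀` is a cyclic vector for `T`. -/
structure IsDiagonalization {W : Type*} [AddCommGroup W] [Module ℝ W]
    (B : LinearMap.BilinForm ℝ W) (T : W →ₗ[ℝ] W) (s : Finset ℂ) (ev : ℂ → W →ₗ[ℝ] ℂ)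
    (κ : ℂ → ℂ) (v₀ : W) : Prop where
  conj_mem : ∀ ω ∈ s, conj ω ∈ s
  ev_T : ∀ ω ∈ s, ∀ v, ev ω (T v) = ω * ev ω v
  ev_conj : ∀ ω ∈ s, ∀ v, ev (conj ω) v = conj (ev ω v)
  ev_injective : ∀ v, (∀ ω ∈ s, ev ω v = 0) → v = 0
  form_eq : ∀ v w, (B v w : ℂ) = ∑ ω ∈ s, κ ω * ev ω v * ev ω w
  ev_cyclic : ∀ ω ∈ s, ev ω v₀ ≠ 0
  coeff_conj : ∀ ω ∈ s, κ (conj ω) = conj (κ ω)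
  coeff_ne_zero : ∀ ω ∈ s, κ ω ≠ 0

section Intertwining

variable {W : Type*} [AddCommGroup W] [Module ℝ W]

theorem aeval_apply_of_intertwine {T S θ : W →ₗ[ℝ] W} (h : ∀ v, θ (T v) = S (θ v)) (p : ℝ[X])
    (v : W) : θ (aeval T p v) = aeval S p (θ v) := by
  induction p using Polynomial.induction_on' with
  | add p q hp hq => simp [hp, hq]
  | monomial n c =>
    rw [aeval_monomial, aeval_monomial, Module.End.mul_apply, Module.End.mul_apply,
      Module.algebraMap_end_apply, Module.algebraMap_end_apply, map_smul]
    congr 1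
    induction n generalizing v with
    | zero => simp
    | succ n ih => rw [pow_succ, pow_succ, Module.End.mul_apply, Module.End.mul_apply, ih, h]

theorem aeval_adjoint {H : LinearMap.BilinForm ℝ W} {T S : W →ₗ[ℝ] W}
    (h : ∀ v w, H (T v) w = H v (S w)) (p : ℝ[X]) (v w : W) :
    H (aeval T p v) w = H v (aeval S p w) := by
  induction p using Polynomial.induction_on' with
  | add p q hp hq => simp [hp, hq]
  | monomial n c =>
    rw [aeval_monomial, aeval_monomial, Module.End.mul_apply, Module.End.mul_apply,
      Module.algebraMap_end_apply, Module.algebraMap_end_apply, map_smul, map_smul,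
      LinearMap.smul_apply]
    congr 1
    induction n generalizing v w with
    | zero => simp
    | succ n ih =>
      rw [pow_succ, pow_succ', Module.End.mul_apply, Module.End.mul_apply, ih, h]

end Intertwining

namespace IsDiagonalization

variable {W : Type*} [AddCommGroup W] [Module ℝ W] {B : LinearMap.BilinForm ℝ W}
  {T : W →ₗ[ℝ] W} {s : Finset ℂ} {ev : ℂ → W →ₗ[ℝ] ℂ} {κ : ℂ → ℂ} {v₀ : W}

theorem ext (h : IsDiagonalization B T s ev κ v₀) {v w : W} (hvw : ∀ ω ∈ s, ev ω v = ev ω w) :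
    v = w :=
  sub_eq_zero.1 (h.ev_injective _ fun ω hω => by rw [map_sub, hvw ω hω, sub_self])

theorem ev_aeval (h : IsDiagonalization B T s ev κ v₀) {ω : ℂ} (hω : ω ∈ s) (p : ℝ[X]) (v : W) :
    ev ω (aeval T p v) = aeval ω p * ev ω v := by
  induction p using Polynomial.induction_on' with
  | add p q hp hq => simp [hp, hq, add_mul]
  | monomial n c =>
    rw [aeval_monomial, aeval_monomial, Module.End.mul_apply, Module.algebraMap_end_apply,
      map_smul, Complex.real_smul, Complex.coe_algebraMap, mul_assoc]
    congr 1
    induction n generalizing v with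
    | zero => simp
    | succ n ih =>
      rw [pow_succ, Module.End.mul_apply, ih, h.ev_T ω hω]
      ring

/-- Every tuple of coordinates compatible with complex conjugation comes from a vector of `W`. -/
theorem exists_ev_eq (h : IsDiagonalization B T s ev κ v₀) {c : ℂ → ℂ}
    (hc : ∀ ω ∈ s, c (conj ω) = conj (c ω)) :
    ∃ p : ℝ[X], ∀ ω ∈ s, ev ω (aeval T p v₀) = c ω := by
  obtain ⟨p, hp⟩ := exists_aeval_eq_of_conj h.conj_mem (c := fun ω => c ω / ev ω v₀)
    (fun ω hω => by rw [hc ω hω, h.ev_conj ω hω, map_div₀])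
  refine ⟨p, fun ω hω => ?_⟩
  rw [h.ev_aeval hω, hp ω hω, div_mul_cancel₀ _ (h.ev_cyclic ω hω)]

theorem exists_eq_aeval_cyclic (h : IsDiagonalization B T s ev κ v₀) (v : W) :
    ∃ p : ℝ[X], v = aeval T p v₀ := by
  obtain ⟨p, hp⟩ := h.exists_ev_eq (c := fun ω => ev ω v) fun ω hω => h.ev_conj ω hω v
  exact ⟨p, h.ext fun ω hω => (hp ω hω).symm⟩

theorem exists_eq_aeval_of_commute (h : IsDiagonalization B T s ev κ v₀) {A : W →ₗ[ℝ] W}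
    (hA : ∀ v, A (T v) = T (A v)) : ∃ p : ℝ[X], ∀ v, A v = aeval T p v := by
  obtain ⟨p, hp⟩ := h.exists_eq_aeval_cyclic (A v₀)
  refine ⟨p, fun v => ?_⟩
  obtain ⟨q, rfl⟩ := h.exists_eq_aeval_cyclic v
  rw [aeval_apply_of_intertwine hA, hp, ← Module.End.mul_apply, ← Module.End.mul_apply, ← map_mul,
    ← map_mul, mul_comm]

/-- There is a conjugate-linear twist `v ↦ θ v` with `ev ω (θ v) = c ω * conj (ev ω v)`, for a
function `c` compatible with complex conjugation. -/
theorem exists_twist (h : IsDiagonalization B T s ev κ v₀) {c : ℂ → ℂ}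
    (hc : ∀ ω ∈ s, c (conj ω) = conj (c ω)) :
    ∃ θ : W →ₗ[ℝ] W, ∀ ω ∈ s, ∀ v, ev ω (θ v) = c ω * conj (ev ω v) := by
  have hex : ∀ v, ∃ w, ∀ ω ∈ s, ev ω w = c ω * conj (ev ω v) := fun v => by
    obtain ⟨p, hp⟩ := h.exists_ev_eq (c := fun ω => c ω * conj (ev ω v)) fun ω hω => by
      rw [hc ω hω, h.ev_conj ω hω, map_mul]
    exact ⟨_, hp⟩
  choose θ hθ using hex
  refine ⟨{ toFun := θ, map_add' := fun v w => h.ext fun ω hω => ?_,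
            map_smul' := fun r v => h.ext fun ω hω => ?_ }, fun ω hω v => hθ v ω hω⟩
  · rw [map_add, hθ _ ω hω, hθ _ ω hω, hθ _ ω hω, map_add, map_add, mul_add]
  · rw [RingHom.id_apply, map_smul, hθ _ ω hω, hθ _ ω hω, map_smul, Complex.real_smul,
      Complex.real_smul, map_mul, Complex.conj_ofReal]
    ring

/-- An adjoint `S` of `T` that commutes with `T`, with respect to some inner product, has eigenvalue
`conj ω` on the `ω`-eigenspace. -/
theorem ev_adjoint (h : IsDiagonalization B T s ev κ v₀) {H : LinearMap.BilinForm ℝ W}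
    (hsymm : ∀ v w, H v w = H w v) (hpos : ∀ v, v ≠ 0 → 0 < H v v) {S : W →ₗ[ℝ] W}
    (hS : ∀ v w, H (T v) w = H v (S w)) (hcomm : ∀ v, S (T v) = T (S v)) {ω : ℂ} (hω : ω ∈ s)
    (v : W) : ev ω (S v) = conj ω * ev ω v := by
  obtain ⟨p, hp⟩ := h.exists_eq_aeval_of_commute hcomm
  rw [hp, h.ev_aeval hω]
  congr 1
  -- `a` and `b` are the real and imaginary parts of an eigenvector with eigenvalue `ω`
  let δ : ℂ → ℂ := fun z => if z = ω then 1 else 0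
  have hδ : ∀ z, δ (conj z) = if z = conj ω then 1 else 0 := fun z => by
    simp only [δ]
    congr 1
    exact propext ⟨fun e => by rw [← e, Complex.conj_conj], fun e => by rw [e, Complex.conj_conj]⟩
  have hδc : ∀ z, conj (δ z) = δ z := fun z => by simp only [δ]; split_ifs <;> simp
  obtain ⟨pa, ha⟩ := h.exists_ev_eq (c := fun z => (δ z + δ (conj z)) / 2) fun z _ => by
    rw [map_div₀, map_add, hδc, hδc, Complex.conj_conj, map_ofNat]
    ring
  obtain ⟨pb, hb⟩ := h.exists_ev_eq (c := fun z => (δ z - δ (conj z)) / (2 * Complex.I))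
    fun z _ => by
      rw [map_div₀, map_sub, hδc, hδc, Complex.conj_conj, map_mul, map_ofNat, Complex.conj_I]
      field_simp
      ring
  set a := aeval T pa v₀
  set b := aeval T pb v₀
  have ha0 : a ≠ 0 := by
    intro h0
    have := ha ω hω
    rw [h0, map_zero, hδ] at this
    simp only [δ, if_true] at this
    split_ifs at this <;> norm_num at this
  have hI : ∀ x y : ℂ, x / (2 * Complex.I) * y = -Complex.I * x * y / 2 := fun x y => by
    have := Complex.I_mul_I
    field_simp
    linear_combination (x * y) * this
  have hreim : ∀ z : ℂ, z = z.re + z.im * Complex.I := fun z => (Complex.re_add_im z).symm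
  have hconj : ∀ z : ℂ, conj z = z.re - z.im * Complex.I := fun z => by
    apply Complex.ext <;> simp
  have hval : ∀ (r : ℝ[X]), ∀ z, aeval z r * δ z = aeval ω r * δ z ∧
      aeval z r * δ (conj z) = conj (aeval ω r) * δ (conj z) := fun r z => by
    rw [hδ, ← aeval_conj]
    constructor
    · simp only [δ]
      split_ifs with e
      · rw [e]
      · simp
    · split_ifs with e
      · rw [e]
      · simp
  have hra : ∀ r : ℝ[X], aeval T r a = (aeval ω r).re • a - (aeval ω r).im • b := fun r => by
    refine h.ext fun z hz => ?_
    obtain ⟨h1, h2⟩ := hval r z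
    rw [hconj (aeval ω r)] at h2
    conv_rhs at h1 => rw [hreim (aeval ω r)]
    rw [h.ev_aeval hz, map_sub, map_smul, map_smul, ha z hz, hb z hz, Complex.real_smul,
      Complex.real_smul, mul_comm (((aeval ω r).im : ℝ) : ℂ) _, hI]
    linear_combination (h1 + h2) / 2
  have hrb : ∀ r : ℝ[X], aeval T r b = (aeval ω r).im • a + (aeval ω r).re • b := fun r => by
    refine h.ext fun z hz => ?_
    obtain ⟨h1, h2⟩ := hval r z
    rw [hconj (aeval ω r)] at h2
    conv_rhs at h1 => rw [hreim (aeval ω r)]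
    rw [h.ev_aeval hz, map_add, map_smul, map_smul, ha z hz, hb z hz, Complex.real_smul,
      Complex.real_smul, mul_comm (((aeval ω r).re : ℝ) : ℂ) _, hI, mul_comm, hI]
    have := Complex.I_mul_I
    linear_combination (-Complex.I / 2) * (h1 - h2)
      + (-((aeval ω r).im : ℂ) * (δ z + δ (conj z)) / 2) * this
  have hTa : T a = ω.re • a - ω.im • b := by simpa using hra X
  have hTb : T b = ω.im • a + ω.re • b := by simpa using hrb X
  have hSa : S a = (aeval ω p).re • a - (aeval ω p).im • b := by rw [hp, hra]
  have hSb : S b = (aeval ω p).im • a + (aeval ω p).re • b := by rw [hp, hrb]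
  -- compare the Hermitian products of `T (a + i b)` and `S (a + i b)` with `a + i b`
  have hnorm : 0 < H a a + H b b := by
    have h1 := hpos a ha0
    have h2 : 0 ≤ H b b := by
      by_cases hb0 : b = 0
      · simp [hb0]
      · exact (hpos b hb0).le
    linarith
  have e₁ := hS a a
  have e₂ := hS b b
  have e₃ := hS a b
  have e₄ := hS b a
  have hab := hsymm a b
  simp only [hTa, hTb, hSa, hSb, map_add, map_sub, map_smul, LinearMap.add_apply,
    LinearMap.sub_apply, LinearMap.smul_apply, smul_eq_mul] at e₁ e₂ e₃ e₄
  apply Complex.ext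
  · rw [Complex.conj_re]
    apply mul_right_cancel₀ hnorm.ne'
    linear_combination -e₁ - e₂ + (ω.im + (aeval ω p).im) * hab
  · rw [Complex.conj_im]
    apply mul_right_cancel₀ hnorm.ne'
    linear_combination -e₃ + e₄ + (ω.re - (aeval ω p).re) * hab

theorem form_symm (h : IsDiagonalization B T s ev κ v₀) (v w : W) : B v w = B w v := by
  have : (B v w : ℂ) = B w v := by
    rw [h.form_eq, h.form_eq]
    exact Finset.sum_congr rfl fun ω _ => by ring
  exact_mod_cast this

theorem form_T (h : IsDiagonalization B T s ev κ v₀) (v w : W) : B (T v) w = B v (T w) := by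
  have : (B (T v) w : ℂ) = B v (T w) := by
    rw [h.form_eq, h.form_eq]
    refine Finset.sum_congr rfl fun ω hω => ?_
    rw [h.ev_T ω hω, h.ev_T ω hω]
    ring
  exact_mod_cast this

/-- Two inner products satisfying the conditions have the same adjoint `S` of `T`. Hence the
product `Q` of the two involutions `θ`, `θ'` commutes with `T`; it is a polynomial in `T`, it is
self-adjoint and positive, and its square is `1`. So it is the identity. -/
theorem eq_of_isReductionInner (h : IsDiagonalization B T s ev κ v₀)
    {H H' : LinearMap.BilinForm ℝ W} (hH : IsReductionInner B T H)
    (hH' : IsReductionInner B T H') : H' = H := by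
  obtain ⟨θ, hθ, hθH⟩ := hH.compatible
  obtain ⟨θ', hθ', hθH'⟩ := hH'.compatible
  obtain ⟨S, hS, hST⟩ := hH.normal
  obtain ⟨S', hS', hST'⟩ := hH'.normal
  have hnd : ∀ {K : LinearMap.BilinForm ℝ W}, IsReductionInner B T K → ∀ v w,
      (∀ x, K v x = K w x) → v = w := fun {K} hK v w e => by
    by_contra hne
    have := hK.pos _ (sub_ne_zero.2 hne)
    rw [LinearMap.map_sub₂, e, sub_self] at this
    exact this.false
  obtain rfl : S' = S := LinearMap.ext fun v => h.ext fun ω hω => by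
    rw [h.ev_adjoint hH.symm hH.pos hS (fun v => (LinearMap.congr_fun hST v).symm) hω,
      h.ev_adjoint hH'.symm hH'.pos hS' (fun v => (LinearMap.congr_fun hST' v).symm) hω]
  have hθT : ∀ {K : LinearMap.BilinForm ℝ W} {η : W ≃ₗ[ℝ] W}, IsReductionInner B T K →
      (∀ v, K (η v) = B v) → LinearMap.IsAdjointPair K K T S' → ∀ v, η (T v) = S' (η v) := by
    intro K η hK hη hKS v
    refine hnd hK _ _ fun x => ?_
    rw [hη, h.form_T, ← hη, hK.symm, hKS, hK.symm]
  have hsq : ∀ {K : LinearMap.BilinForm ℝ W} {η : W ≃ₗ[ℝ] W}, IsReductionInner B T K →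
      (∀ v, K (η v) = B v) → (∀ v w, K (η v) (η w) = K v w) → ∀ v, η (η v) = v := by
    intro K η hK hη hηK v
    refine hnd hK _ _ fun x => ?_
    rw [hη, h.form_symm, ← hη, hK.symm, hηK]
  have h1 := hθT hH hθ hS
  have h1' := hθT hH' hθ' hS'
  have h2 := hsq hH hθ hθH
  have h2' := hsq hH' hθ' hθH'
  have h3 : ∀ v, θ (S' v) = T (θ v) := fun v => by
    rw [← h2 (T (θ v)), h1, h2]
  have hQ : ∀ v w, H' v w = H (θ (θ' v)) w := fun v w => by
    rw [hθ, ← hθ', h2']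
  obtain ⟨u, hu⟩ := h.exists_eq_aeval_of_commute
    (A := (θ : W →ₗ[ℝ] W).comp (θ' : W →ₗ[ℝ] W)) fun v => by
      simp only [LinearMap.comp_apply, LinearEquiv.coe_coe, h1', h3]
  simp only [LinearMap.comp_apply, LinearEquiv.coe_coe] at hu
  have hu' : ∀ v, aeval S' u v = θ (θ' v) := fun v => by
    refine hnd hH _ _ fun x => ?_
    rw [hH.symm, ← aeval_adjoint (fun v w => hS v w), ← hu, ← hQ, hH'.symm, hQ]
  have hcomm : ∀ v, θ (θ' v) = θ' (θ v) := fun v => by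
    have h4 := aeval_apply_of_intertwine (θ := (θ : W →ₗ[ℝ] W)) h1 u v
    simp only [LinearEquiv.coe_coe] at h4
    rw [hu', ← hu, h2] at h4
    rw [h4, h2]
  have hQ2 : ∀ v, θ (θ' (θ (θ' v))) = v := fun v => by
    rw [← hcomm (θ' v), h2', h2]
  have hQ1 : ∀ v, θ (θ' v) = v := fun v => by
    have h4 : v - θ (θ' v) = 0 := by
      by_contra h0
      have h5 := hH.pos _ h0
      have h6 := hH'.pos _ h0
      have h7 : θ (θ' (v - θ (θ' v))) = -(v - θ (θ' v)) := by
        rw [map_sub, map_sub, hQ2, neg_sub]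
      rw [hQ, h7, map_neg, LinearMap.neg_apply] at h6
      linarith
    exact (sub_eq_zero.1 h4).symm
  ext v w
  rw [hQ, hQ1]

end IsDiagonalization

/-! ### The inner product of a diagonalised operator -/

/-- The real inner product `∑ |κ ω| x ω conj (y ω)` attached to a diagonalisation. -/
noncomputable def diagonalInner {W : Type*} [AddCommGroup W] [Module ℝ W] (s : Finset ℂ)
    (ev : ℂ → W →ₗ[ℝ] ℂ) (κ : ℂ → ℂ) : LinearMap.BilinForm ℝ W :=
  LinearMap.mk₂ ℝ (fun v w => (∑ ω ∈ s, ‖κ ω‖ * ev ω v * conj (ev ω w)).re)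
    (fun v v' w => by
      rw [← Complex.add_re, ← Finset.sum_add_distrib]
      congr 1
      exact Finset.sum_congr rfl fun ω _ => by rw [map_add]; ring)
    (fun c v w => by
      rw [smul_eq_mul, ← Complex.re_ofReal_mul, Finset.mul_sum]
      congr 1
      exact Finset.sum_congr rfl fun ω _ => by rw [map_smul, Complex.real_smul]; ring)
    (fun v w w' => by
      rw [← Complex.add_re, ← Finset.sum_add_distrib]
      congr 1
      exact Finset.sum_congr rfl fun ω _ => by rw [map_add, map_add]; ring)
    (fun c v w => by
      rw [smul_eq_mul, ← Complex.re_ofReal_mul, Finset.mul_sum]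
      congr 1
      exact Finset.sum_congr rfl fun ω _ => by
        rw [map_smul, Complex.real_smul, map_mul, Complex.conj_ofReal]; ring)

section diagonalInner

variable {W : Type*} [AddCommGroup W] [Module ℝ W] {s : Finset ℂ} {ev : ℂ → W →ₗ[ℝ] ℂ} {κ : ℂ → ℂ}

theorem diagonalInner_apply (v w : W) : diagonalInner s ev κ v w
    = (∑ ω ∈ s, ‖κ ω‖ * ev ω v * conj (ev ω w)).re := rfl

theorem diagonalInner_self (v : W) : diagonalInner s ev κ v v = ∑ ω ∈ s, ‖κ ω‖ * ‖ev ω v‖ ^ 2 := by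
  rw [diagonalInner_apply, Complex.re_sum]
  refine Finset.sum_congr rfl fun ω _ => ?_
  rw [mul_assoc, Complex.mul_conj, Complex.re_ofReal_mul, Complex.ofReal_re,
    Complex.normSq_eq_norm_sq]

theorem diagonalInner_symm (v w : W) : diagonalInner s ev κ v w = diagonalInner s ev κ w v := by
  rw [diagonalInner_apply, diagonalInner_apply, ← Complex.conj_re, map_sum]
  congr 1
  refine Finset.sum_congr rfl fun ω _ => ?_
  rw [map_mul, map_mul, Complex.conj_conj, Complex.conj_ofReal]
  ring

end diagonalInner

namespace IsDiagonalization

variable {W : Type*} [AddCommGroup W] [Module ℝ W] {B : LinearMap.BilinForm ℝ W}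
  {T : W →ₗ[ℝ] W} {s : Finset ℂ} {ev : ℂ → W →ₗ[ℝ] ℂ} {κ : ℂ → ℂ} {v₀ : W}

theorem isReductionInner_diagonalInner (h : IsDiagonalization B T s ev κ v₀) :
    IsReductionInner B T (diagonalInner s ev κ) where
  symm := diagonalInner_symm
  pos v hv := by
    rw [diagonalInner_self]
    obtain ⟨ω, hω, hne⟩ : ∃ ω ∈ s, ev ω v ≠ 0 := by
      by_contra! h0
      exact hv (h.ev_injective v h0)
    refine Finset.sum_pos' (fun _ _ => by positivity) ⟨ω, hω, ?_⟩
    have := norm_pos_iff.2 hne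
    have := norm_pos_iff.2 (h.coeff_ne_zero ω hω)
    positivity
  compatible := by
    have hnorm : ∀ ω ∈ s, (‖κ ω‖ : ℂ) ≠ 0 := fun ω hω => by
      simpa using h.coeff_ne_zero ω hω
    obtain ⟨θ, hθ⟩ := h.exists_twist (c := fun ω => conj (κ ω) / ‖κ ω‖) fun ω hω => by
      rw [h.coeff_conj ω hω, map_div₀, Complex.conj_ofReal, RCLike.norm_conj]
    have hc : ∀ ω ∈ s, conj (κ ω) / ‖κ ω‖ * (κ ω / ‖κ ω‖) = 1 := fun ω hω => by
      have := hnorm ω hω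
      field_simp
      rw [mul_comm, Complex.mul_conj, Complex.normSq_eq_norm_sq]
      push_cast
      rfl
    have hinv : ∀ v, θ (θ v) = v := fun v => h.ext fun ω hω => by
      rw [hθ ω hω, hθ ω hω, map_mul, map_div₀, Complex.conj_conj, Complex.conj_conj,
        Complex.conj_ofReal, ← mul_assoc, hc ω hω, one_mul]
    refine ⟨LinearEquiv.ofInvolutive θ hinv, fun v => ?_, fun v w => ?_⟩
    · ext w
      change diagonalInner s ev κ (θ v) w = B v w
      rw [diagonalInner_apply, ← Complex.ofReal_re (B v w), h.form_eq, ← Complex.conj_re, map_sum]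
      congr 1
      refine Finset.sum_congr rfl fun ω hω => ?_
      have := hnorm ω hω
      rw [hθ ω hω, map_mul, map_mul, map_mul, map_div₀, Complex.conj_conj, Complex.conj_conj,
        Complex.conj_conj, Complex.conj_ofReal]
      field_simp
    · change diagonalInner s ev κ (θ v) (θ w) = _
      rw [diagonalInner_symm v, diagonalInner_apply, diagonalInner_apply]
      congr 1
      refine Finset.sum_congr rfl fun ω hω => ?_
      rw [hθ ω hω, hθ ω hω, map_mul, map_div₀, Complex.conj_conj, Complex.conj_conj,
        Complex.conj_ofReal]
      linear_combination (‖κ ω‖ * conj (ev ω v) * ev ω w) * hc ω hω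
  normal := by
    obtain ⟨p, hp⟩ := exists_aeval_eq_of_conj h.conj_mem (c := fun ω => conj ω) fun _ _ => rfl
    refine ⟨aeval T p, fun v w => ?_, LinearMap.ext fun v => ?_⟩
    · rw [diagonalInner_apply, diagonalInner_apply]
      congr 1
      refine Finset.sum_congr rfl fun ω hω => ?_
      rw [h.ev_T ω hω, h.ev_aeval hω, hp ω hω, map_mul, Complex.conj_conj]
      ring
    · exact aeval_apply_of_intertwine (fun _ => rfl) p v

/-- The diagonal inner product is the only one that satisfies the conditions. -/
theorem isReductionInner_iff (h : IsDiagonalization B T s ev κ v₀) {H : LinearMap.BilinForm ℝ W} :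
    IsReductionInner B T H ↔ H = diagonalInner s ev κ :=
  ⟨fun hH => h.eq_of_isReductionInner h.isReductionInner_diagonalInner hH,
    fun e => e ▸ h.isReductionInner_diagonalInner⟩

end IsDiagonalization

/-! ### The roots of `f` diagonalise `W_D` -/

section Roots

variable {f : ℤ[X]}

theorem separable_map_of_discr_ne_zero (hf_deg : 0 < f.natDegree) (hd : f.discr ≠ 0)
    (hf : f.Monic) : (f.map (algebraMap ℤ ℂ)).Separable := by
  have hres := resultant_deriv (f := f) (natDegree_pos_iff_degree_pos.1 hf_deg)
  obtain ⟨p, q, -, -, h⟩ := exists_mul_add_mul_eq_C_resultant f (derivative f)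
    (m := f.natDegree) (n := f.natDegree - 1) le_rfl (natDegree_derivative_le f)
    (.inl hf_deg.ne')
  set r := f.resultant (derivative f) f.natDegree (f.natDegree - 1)
  have hr : (algebraMap ℤ ℂ r) ≠ 0 := by
    rw [hres, hf.leadingCoeff, mul_one, eq_intCast, Int.cast_ne_zero]
    exact mul_ne_zero (pow_ne_zero _ (by norm_num)) hd
  have h' := congrArg (Polynomial.map (algebraMap ℤ ℂ)) h
  rw [Polynomial.map_add, Polynomial.map_mul, Polynomial.map_mul, map_C] at h'
  refine ⟨C (algebraMap ℤ ℂ r)⁻¹ * p.map (algebraMap ℤ ℂ),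
    C (algebraMap ℤ ℂ r)⁻¹ * q.map (algebraMap ℤ ℂ), ?_⟩
  have h1 : C (algebraMap ℤ ℂ r)⁻¹ * C (algebraMap ℤ ℂ r) = 1 := by
    rw [← C_mul, inv_mul_cancel₀ hr, C_1]
  rw [derivative_map]
  linear_combination C (algebraMap ℤ ℂ r)⁻¹ * h' + h1

/-- Euler's formula: the coefficient of degree `deg f - 1` of a polynomial `h` of degree less than
`deg f` is `∑ h(ω) / f'(ω)`, where `ω` runs over the roots of `f`. -/
theorem coeff_eq_sum_roots (hf : f.Monic) {n : ℕ} (hn : f.natDegree = n + 1)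
    (hsep : (f.map (algebraMap ℤ ℂ)).Separable) {h : ℂ[X]} (hh : h.degree < f.natDegree) :
    h.coeff n = ∑ ω ∈ (f.aroots ℂ).toFinset, h.eval ω / aeval ω (derivative f) := by
  classical
  set s := (f.aroots ℂ).toFinset
  have hnodup : (f.aroots ℂ).Nodup := nodup_roots hsep
  have hsval : s.val = f.aroots ℂ := by
    rw [Multiset.toFinset_val, Multiset.dedup_eq_self.2 hnodup]
  have hcard : s.card = n + 1 := by
    rw [Finset.card_def, hsval, aroots, ← (IsAlgClosed.splits _).natDegree_eq_card_roots,
      hf.natDegree_map, hn]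
  have hprod : f.map (algebraMap ℤ ℂ) = Lagrange.nodal s id := by
    rw [(IsAlgClosed.splits (f.map (algebraMap ℤ ℂ))).eq_prod_roots_of_monic (hf.map _),
      Lagrange.nodal, Finset.prod, hsval]
    rfl
  have h1 := Lagrange.coeff_eq_sum (s := s) (v := id) Function.injective_id.injOn (P := h)
    (by rw [hcard, ← hn]; exact hh)
  rw [hcard, Nat.add_sub_cancel] at h1
  rw [h1]
  refine Finset.sum_congr rfl fun ω hω => ?_
  have h2 : aeval ω (derivative f) = ∏ j ∈ s.erase ω, (id ω - id j) := by
    rw [← eval_map_algebraMap, ← derivative_map, hprod]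
    have := Lagrange.eval_nodal_derivative_eval_node_eq (s := s) (v := (id : ℂ → ℂ)) hω
    rw [Lagrange.eval_nodal] at this
    exact this
  rw [h2]
  rfl

end Roots

namespace MumfordTriple

open CurveRing

section Field

variable {k : Type*} [Field k] {g : ℕ} {f : k[X]} (D : MumfordTriple g f)

theorem phi_classElt_classU {p q : k[X]} (h : D.U ∣ p + q * D.R) :
    D.phi (D.classElt p q h) D.classU = AdjoinRoot.mk f p := by
  rw [classU_eq]
  exact D.phi_classElt _ _ (by ring)

/-- Evaluation of sections of `𝒪(-D)` at the Weierstrass point `(ω, 0)`, for a root `ω` of `f` in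
an extension field; it is computed as the value of the pairing with `U`. -/
noncomputable def evalW {K : Type*} [Field K] [Algebra k K] (ω : K) : D.W →ₗ[k] K :=
  (aeval ω : k[X] →ₐ[k] K).toLinearMap ∘ₗ AdjoinRoot.modByMonicHom D.monic_f ∘ₗ
    D.phi.flip D.classU

theorem evalW_classElt {K : Type*} [Field K] [Algebra k K] {ω : K} (hω : aeval ω f = 0)
    {p q : k[X]} (h : D.U ∣ p + q * D.R) : D.evalW ω (D.classElt p q h) = aeval ω p := by
  change aeval ω (AdjoinRoot.modByMonicHom D.monic_f (D.phi (D.classElt p q h) D.classU)) = _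
  rw [phi_classElt_classU, AdjoinRoot.modByMonicHom_mk]
  exact aeval_modByMonic_eq_self_of_root hω

theorem evalW_T {K : Type*} [Field K] [Algebra k K] {ω : K} (hω : aeval ω f = 0) (v : D.W) :
    D.evalW ω (D.T v) = ω * D.evalW ω v := by
  obtain ⟨p, q, h, rfl⟩ := D.exists_eq_classElt v
  rw [T_apply, ← classElt_mul, D.evalW_classElt hω, D.evalW_classElt hω, map_mul, aeval_X]

end Field

variable {g : ℕ} {f : ℤ[X]} (D : MumfordTriple g (f.map (Int.castRingHom ℚ)))

/-- The Gram determinant of the standard basis is nonzero. -/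
theorem baseChange_form_nondegenerate {v : ℝ ⊗[ℚ] D.W}
    (hv : ∀ w, D.form.baseChange ℝ v w = 0) : v = 0 := by
  let b := Algebra.TensorProduct.basis ℝ D.stdBasis
  let G := LinearMap.BilinForm.toMatrix D.stdBasis D.form
  have hG : ∀ i j, G i j = D.form (D.stdBasis i) (D.stdBasis j) := fun i j =>
    LinearMap.BilinForm.toMatrix_apply _ _ i j
  have hdet : (G.map (algebraMap ℚ ℝ)).det ≠ 0 := by
    have h1 : algebraMap ℚ ℝ G.det = (G.map (algebraMap ℚ ℝ)).det := by
      rw [RingHom.map_det]; rfl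
    rw [← h1]
    intro h0
    have h2 := D.det_toMatrix_stdBasis_sq
    rw [(map_eq_zero _).1 h0] at h2
    norm_num at h2
  have h0 := Matrix.eq_zero_of_vecMul_eq_zero hdet (v := fun i => b.repr v i) (by
    ext j
    have := hv (b j)
    conv_lhs at this => rw [← b.sum_repr v]
    rw [Pi.zero_apply, ← this, map_sum, LinearMap.sum_apply]
    simp only [Matrix.vecMul, dotProduct]
    refine Finset.sum_congr rfl fun i _ => ?_
    rw [map_smul, LinearMap.smul_apply, Algebra.TensorProduct.basis_apply,
      Algebra.TensorProduct.basis_apply, LinearMap.BilinForm.baseChange_tmul, Matrix.map_apply, hG]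
    simp [Algebra.smul_def])
  exact b.repr.map_eq_zero_iff.1 (Finsupp.ext fun i => congrFun h0 i)

theorem aeval_map_intCast (ω : ℂ) (p : ℤ[X]) :
    aeval ω (p.map (Int.castRingHom ℚ)) = aeval ω p :=
  aeval_map_algebraMap ℚ ω p

theorem mem_aroots_toFinset (hf : f.Monic) {ω : ℂ} :
    ω ∈ (f.aroots ℂ).toFinset ↔ aeval ω f = 0 := by
  rw [Multiset.mem_toFinset, mem_aroots]
  exact ⟨fun h => h.2, fun h => ⟨hf.ne_zero, h⟩⟩

theorem aeval_conj_of_int (p : ℤ[X]) (ω : ℂ) : aeval (conj ω) p = conj (aeval ω p) :=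
  aeval_algHom_apply (Complex.conjAe.toAlgHom.restrictScalars ℤ) ω p

theorem aeval_conj_of_rat (p : ℚ[X]) (ω : ℂ) : aeval (conj ω) p = conj (aeval ω p) :=
  aeval_algHom_apply (Complex.conjAe.toAlgHom.restrictScalars ℚ) ω p

/-- If `U` and `f` are coprime, evaluation at the Weierstrass points diagonalises `W_D ⊗ ℝ`. -/
theorem isDiagonalization (hf : f.Monic) (hsep : (f.map (algebraMap ℤ ℂ)).Separable)
    (hU : IsCoprime D.U (f.map (Int.castRingHom ℚ))) :
    IsDiagonalization (D.form.baseChange ℝ) (D.T.baseChange ℝ) (f.aroots ℂ).toFinset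
      (fun ω => LinearMap.liftBaseChange ℝ (D.evalW ω))
      (fun ω => (-1) ^ D.U.natDegree / (aeval ω D.U * aeval ω (derivative f)))
      (1 ⊗ₜ[ℚ] D.classU) := by
  have hdeg : f.natDegree = 2 * g + 1 := by
    rw [← D.natDegree_f, hf.natDegree_map]
  have hroot : ∀ {ω : ℂ}, ω ∈ (f.aroots ℂ).toFinset → aeval ω (f.map (Int.castRingHom ℚ)) = 0 :=
    fun hω => by rw [aeval_map_intCast]; exact (mem_aroots_toFinset hf).1 hω
  have hU0 : ∀ ω ∈ (f.aroots ℂ).toFinset, aeval ω D.U ≠ 0 := fun ω hω h0 => by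
    obtain ⟨a, b, e⟩ := hU
    have := congrArg (aeval ω) e
    rw [map_add, map_mul, map_mul, h0, hroot hω] at this
    simp at this
  have hf0 : ∀ ω ∈ (f.aroots ℂ).toFinset, aeval ω (derivative f) ≠ 0 := fun ω hω h0 => by
    have := hsep.eval₂_derivative_ne_zero (RingHom.id ℂ) (x := ω) (by
      rw [eval₂_id, eval_map_algebraMap]
      exact (mem_aroots_toFinset hf).1 hω)
    rw [eval₂_id, derivative_map, eval_map_algebraMap] at this
    exact this h0
  have hform : ∀ v w : D.W, (D.form v w : ℂ) = ∑ ω ∈ (f.aroots ℂ).toFinset,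
      (-1) ^ D.U.natDegree / (aeval ω D.U * aeval ω (derivative f)) * D.evalW ω v
        * D.evalW ω w := by
    intro v w
    obtain ⟨p, q, h, rfl⟩ := D.exists_eq_classElt v
    obtain ⟨p', q', h', rfl⟩ := D.exists_eq_classElt w
    obtain ⟨e, he⟩ := D.dvd_norm_pair h h'
    have h1 := coeff_eq_sum_roots hf hdeg hsep
      (h := (e %ₘ f.map (Int.castRingHom ℚ)).map (algebraMap ℚ ℂ)) (by
        refine (degree_map_le).trans_lt ((degree_modByMonic_lt e D.monic_f).trans_eq ?_)
        rw [degree_eq_natDegree D.monic_f.ne_zero, hf.natDegree_map])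
    rw [coeff_map] at h1
    rw [D.form_classElt h h' he]
    push_cast
    rw [← eq_ratCast (algebraMap ℚ ℂ), h1, Finset.mul_sum]
    refine Finset.sum_congr rfl fun ω hω => ?_
    have h2 := congrArg (aeval ω) he
    simp only [map_sub, map_mul, hroot hω, mul_zero, sub_zero] at h2
    have h3 := hU0 ω hω
    have h4 := hf0 ω hω
    rw [eval_map_algebraMap, aeval_modByMonic_eq_self_of_root (hroot hω),
      D.evalW_classElt (hroot hω), D.evalW_classElt (hroot hω)]
    field_simp
    linear_combination -h2
  have hform' : ∀ v w : ℝ ⊗[ℚ] D.W, (D.form.baseChange ℝ v w : ℂ) =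
      ∑ ω ∈ (f.aroots ℂ).toFinset, (-1) ^ D.U.natDegree / (aeval ω D.U * aeval ω (derivative f))
        * LinearMap.liftBaseChange ℝ (D.evalW ω) v * LinearMap.liftBaseChange ℝ (D.evalW ω) w := by
    intro v w
    induction v using TensorProduct.induction_on with
    | zero => simp
    | add v v' hv hv' =>
      rw [map_add, LinearMap.add_apply, Complex.ofReal_add, hv, hv', ← Finset.sum_add_distrib]
      exact Finset.sum_congr rfl fun ω _ => by rw [map_add]; ring
    | tmul r v =>
      induction w using TensorProduct.induction_on with
      | zero => simp
      | add w w' hw hw' =>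
        rw [map_add, Complex.ofReal_add, hw, hw', ← Finset.sum_add_distrib]
        exact Finset.sum_congr rfl fun ω _ => by rw [map_add]; ring
      | tmul r' w =>
        rw [LinearMap.BilinForm.baseChange_tmul, Rat.smul_def]
        push_cast
        rw [hform, Finset.sum_mul]
        refine Finset.sum_congr rfl fun ω _ => ?_
        rw [LinearMap.liftBaseChange_tmul, LinearMap.liftBaseChange_tmul, Complex.real_smul,
          Complex.real_smul]
        ring
  refine
    { conj_mem := fun ω hω => ?_
      ev_T := fun ω hω v => ?_
      ev_conj := fun ω hω v => ?_
      ev_injective := fun v hv => ?_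
      form_eq := hform'
      ev_cyclic := fun ω hω => ?_
      coeff_conj := fun ω hω => ?_
      coeff_ne_zero := fun ω hω => ?_ }
  · rw [mem_aroots_toFinset hf] at hω ⊢
    rw [aeval_conj_of_int, hω, map_zero]
  · induction v using TensorProduct.induction_on with
    | zero => simp
    | tmul r v =>
      rw [LinearMap.baseChange_tmul, LinearMap.liftBaseChange_tmul, LinearMap.liftBaseChange_tmul,
        D.evalW_T (hroot hω), mul_smul_comm]
    | add v w hv hw => rw [map_add, map_add, map_add, hv, hw, mul_add]
  · have hω' : aeval (conj ω) (f.map (Int.castRingHom ℚ)) = 0 := by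
      rw [aeval_conj_of_rat, hroot hω, map_zero]
    induction v using TensorProduct.induction_on with
    | zero => simp
    | tmul r v =>
      obtain ⟨p, q, h, rfl⟩ := D.exists_eq_classElt v
      rw [LinearMap.liftBaseChange_tmul, LinearMap.liftBaseChange_tmul, D.evalW_classElt hω',
        D.evalW_classElt (hroot hω), aeval_conj_of_rat, Complex.real_smul, Complex.real_smul,
        map_mul, Complex.conj_ofReal]
    | add v w hv hw => rw [map_add, map_add, hv, hw, map_add]
  · refine D.baseChange_form_nondegenerate fun w => ?_
    have h1 := hform' v w
    rw [Finset.sum_eq_zero fun ω hω => by rw [hv ω hω, mul_zero, zero_mul]] at h1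
    exact_mod_cast h1
  · rw [LinearMap.liftBaseChange_tmul, one_smul, classU_eq, D.evalW_classElt (hroot hω)]
    exact hU0 ω hω
  · rw [aeval_conj_of_rat, aeval_conj_of_int, map_div₀, map_mul, map_pow, map_neg, map_one]
  · exact div_ne_zero (pow_ne_zero _ (by norm_num)) (mul_ne_zero (hU0 ω hω) (hf0 ω hω))

theorem isReductionInner_smul_classU (hf : f.Monic)
    (hsep : (f.map (algebraMap ℤ ℂ)).Separable)
    (hU : IsCoprime D.U (f.map (Int.castRingHom ℚ))) (N : ℕ)
    {H : LinearMap.BilinForm ℝ (ℝ ⊗[ℚ] D.W)}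
    (hH : IsReductionInner (D.form.baseChange ℝ) (D.T.baseChange ℝ) H) :
    H (1 ⊗ₜ[ℚ] (N • D.classU)) (1 ⊗ₜ[ℚ] (N • D.classU)) =
      ((N ^ 2 : ℕ) : ℝ) * ((f.aroots ℂ).map fun ω : ℂ =>
        ‖aeval ω D.U‖ / ‖aeval ω (derivative f)‖).sum := by
  have hD := D.isDiagonalization hf hsep hU
  rw [hD.isReductionInner_iff.1 hH, diagonalInner_self]
  have hsval : (f.aroots ℂ).toFinset.val = f.aroots ℂ := by
    rw [Multiset.toFinset_val, Multiset.dedup_eq_self.2 (nodup_roots hsep)]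
  have hsum : ∀ F : ℂ → ℝ, ((f.aroots ℂ).map F).sum = ∑ ω ∈ (f.aroots ℂ).toFinset, F ω :=
    fun F => by rw [Finset.sum, hsval]
  rw [hsum, Finset.mul_sum]
  refine Finset.sum_congr rfl fun ω hω => ?_
  have h0 := hD.ev_cyclic ω hω
  have hroot : aeval ω (f.map (Int.castRingHom ℚ)) = 0 := by
    rw [aeval_map_intCast]
    exact (mem_aroots_toFinset hf).1 hω
  rw [LinearMap.liftBaseChange_tmul, one_smul, classU_eq, D.evalW_classElt hroot] at h0
  rw [LinearMap.liftBaseChange_tmul, one_smul, map_nsmul, classU_eq, D.evalW_classElt hroot,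
    norm_div, norm_pow, norm_neg, norm_one, one_pow, norm_mul, nsmul_eq_mul, norm_mul,
    Complex.norm_natCast]
  have h1 := norm_ne_zero_iff.2 h0
  push_cast
  field_simp

end MumfordTriple

theorem theorem4p10 (g : ℕ) (hg : 1 ≤ g) (f : ℤ[X]) (hf_monic : f.Monic)
    (hf_deg : f.natDegree = 2 * g + 1) (hf_coeff : f.coeff (2 * g) = 0) (hf_discr : f.discr ≠ 0)
    (D : MumfordTriple g (f.map (Int.castRingHom ℚ))) (M : ℕ)
    (hM : IsLeast {m : ℕ | 0 < m ∧ ∃ P : ℤ[X], P.map (Int.castRingHom ℚ) = C (m : ℚ) * D.U} M) :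
    ∃ N : ℕ, M = N ^ 2 ∧
      (IsCoprime D.U (f.map (Int.castRingHom ℚ)) →
        (∃! H : LinearMap.BilinForm ℝ (ℝ ⊗[ℚ] D.W),
          IsReductionInner (D.form.baseChange ℝ) (D.T.baseChange ℝ) H) ∧
        ∃ L : Submodule ℤ D.W,
          IsUnimodularZLattice D.form L ∧ (∀ v ∈ L, D.T v ∈ L) ∧
          IsPrimitiveVector L (N • D.classU) ∧
          ∀ H : LinearMap.BilinForm ℝ (ℝ ⊗[ℚ] D.W),
            IsReductionInner (D.form.baseChange ℝ) (D.T.baseChange ℝ) H →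
            H (1 ⊗ₜ[ℚ] (N • D.classU)) (1 ⊗ₜ[ℚ] (N • D.classU)) =
              (M : ℝ) * ((f.aroots ℂ).map fun ω : ℂ =>
                ‖aeval ω D.U‖ / ‖aeval ω (derivative f)‖).sum) := by
  obtain ⟨P, hP⟩ := hM.1.2
  have h : D.IsLeastMultiple M P := ⟨hP, hM⟩
  obtain ⟨N, hN⟩ := h.exists_eq_sq hf_monic
  refine ⟨N, hN, fun hU => ⟨?_, D.lattice (N : ℚ)⁻¹, h.isUnimodularZLattice hf_monic hN,
    fun v hv => D.T_mem_lattice hv, h.isPrimitiveVector hf_monic hN, fun H hH => ?_⟩⟩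
  · have hsep := separable_map_of_discr_ne_zero (by omega) hf_discr hf_monic
    have hD := D.isDiagonalization hf_monic hsep hU
    exact ⟨_, hD.isReductionInner_diagonalInner, fun H hH => hD.isReductionInner_iff.1 hH⟩
  · have hsep := separable_map_of_discr_ne_zero (by omega) hf_discr hf_monic
    rw [hN]
    exact D.isReductionInner_smul_classU hf_monic hsep hU N hH
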